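/- Let $d\ge 1$, $0<H<1$, and $\beta=1/m$ with an integer $m\ge 2$. Let $W=\{W(t),t\in\mathbb R\}$ be a fractional Brownian motion in $\mathbb R^d$ of Hurst index $H$, with almost surely continuous paths: its coordinates are independent centered Gaussian processes with covariance $\frac12\big(|t|^{2H}+|s|^{2H}-|t-s|^{2H}\big)$. Let $Y=\{Y(t),t\ge 0\}$ be a stable subordinator of index $\beta/2$, independent of $W$, normalized by $\mathbb E\,e^{-\lambda Y(t)}=e^{-t\lambda^{\beta/2}}$ for $\lambda\ge 0$. Then for every $t>0$ the random variable $Y(t)$ has a Lebesgue density $p_t$, and $W(Y(t))$ has the density $$q(t,x)=\int_0^\infty f^H(s,x)\,p_t(s)\,ds,\qquad f^H(s,x)=\frac{e^{-|x|^2/(2s^{2H})}}{(2\pi s^{2H})^{d/2}}.$$ For $\gamma\neq 0$ put $$V_{\gamma,t}\,q(t,x)=\int_0^\infty s^{\gamma}f^H(s,x)\,p_t(s)\,ds ,$$ and let $V_{0,t}$ be the identity, i.e. $V_{0,t}\,q(t,x)=q(t,x)$. For $\gamma=2H-1$ this integral and the one defining $q$ converge absolutely for all $t>0$ and $x\in\mathbb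 R^d$; the function $t\mapsto q(t,x)$ is $2m$ times continuously differentiable on $(0,\infty)$ for every $x$; the function $x\mapsto V_{2H-1,t}\,q(t,x)$ is twice continuously differentiable on $\mathbb R^d$ for every $t>0$; and $q$ is a classical solution of $$\frac{\partial^{2m}}{\partial t^{2m}}q(t,x)=-H\,\Delta V_{2H-1,t}\,q(t,x),\qquad t>0,\ x\in\mathbb R^d,$$ where $\Delta=\sum_{j=1}^d\partial^2/\partial x_j^2$ acts on the variable $x$. -/

import Mathlib

open MeasureTheory ProbabilityTheory Set Filter
open scoped NNReal ENNReal Topology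

noncomputable section

namespace StableTimeFBM

variable {Ω : Type*} [MeasurableSpace Ω]

/-- A real-valued fractional Brownian motion `B = {B(t), t ∈ ℝ}` of Hurst index `H`: a centered
Gaussian process with `E[B(t) B(s)] = (|t|^{2H} + |s|^{2H} - |t - s|^{2H}) / 2`, with `B(0) = 0`
almost surely and almost surely continuous sample paths. -/
structure IsFBM (H : ℝ) (B : ℝ → Ω → ℝ) (μ : Measure Ω) : Prop where
  measurable : ∀ t, Measurable (B t)
  gaussian : IsGaussianProcess B μ
  zero : ∀ᵐ ω ∂μ, B 0 ω = 0
  centered : ∀ t, ∫ ω, B t ω ∂μ = 0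
  covariance : ∀ t s, ∫ ω, B t ω * B s ω ∂μ
    = (1 / 2) * (|t| ^ (2 * H) + |s| ^ (2 * H) - |t - s| ^ (2 * H))
  continuous : ∀ᵐ ω ∂μ, Continuous (fun t => B t ω)

/-- A fractional Brownian motion in `ℝ^d` of Hurst index `H`: its coordinate processes are
independent real-valued fractional Brownian motions of index `H`. -/
structure IsFBMVec {d : ℕ} (H : ℝ) (W : ℝ → Ω → EuclideanSpace ℝ (Fin d)) (μ : Measure Ω) :
    Prop where
  coord : ∀ i, IsFBM H (fun t ω => W t ω i) μ
  indep : iIndepFun (fun (i : Fin d) (ω : Ω) (t : ℝ) => W t ω i) μ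

/-- A stable subordinator of index `α`, with the normalization `E[e^{-l Y(t)}] = e^{-t l^α}`:
a stochastically continuous process started at `0` with stationary independent increments and
nondecreasing paths, having this Laplace transform. -/
structure IsStableSubordinator (α : ℝ) (Y : ℝ≥0 → Ω → ℝ) (μ : Measure Ω) : Prop where
  measurable : ∀ t, Measurable (Y t)
  zero : ∀ᵐ ω ∂μ, Y 0 ω = 0
  indepIncrements : HasIndepIncrements Y μ
  stationaryIncrements : ∀ s t, IdentDistrib (fun ω => Y (s + t) ω - Y s ω) (Y t) μ μ
  stochContinuous : ∀ t, TendstoInMeasure μ Y (𝓝 t) (Y t)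
  monotone : ∀ᵐ ω ∂μ, Monotone (fun t => Y t ω)
  laplace : ∀ (t : ℝ≥0) (l : ℝ), 0 ≤ l →
    ∫ ω, Real.exp (-l * Y t ω) ∂μ = Real.exp (-(t : ℝ) * l ^ α)

/-- `f^H(s, x) = (2π s^{2H})^{-d/2} exp(-|x|^2 / (2 s^{2H}))`, the density at `x` of a fractional
Brownian motion in `ℝ^d` of index `H` at time `s > 0`. -/
def fH {d : ℕ} (H s : ℝ) (x : EuclideanSpace ℝ (Fin d)) : ℝ :=
  Real.exp (-‖x‖ ^ 2 / (2 * s ^ (2 * H))) / (2 * Real.pi * s ^ (2 * H)) ^ ((d : ℝ) / 2)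

/-- `p_t(s)`: the Lebesgue density of the random variable `Y(t)` at `s` (used for `t > 0`). -/
def pY (Y : ℝ≥0 → Ω → ℝ) (μ : Measure Ω) (t s : ℝ) : ℝ :=
  (pdf (Y t.toNNReal) μ volume s).toReal

/-- `q(t, x) = ∫_0^∞ f^H(s, x) p_t(s) ds`. -/
def q {d : ℕ} (H : ℝ) (p : ℝ → ℝ → ℝ) (t : ℝ) (x : EuclideanSpace ℝ (Fin d)) : ℝ :=
  ∫ s in Ioi (0 : ℝ), fH H s x * p t s

open Classical in
/-- `V_{γ,t} q(t, x) = ∫_0^∞ s^γ f^H(s, x) p_t(s) ds` for `γ ≠ 0`; `V_{0,t}` is the identity. -/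
def Vq {d : ℕ} (H : ℝ) (p : ℝ → ℝ → ℝ) (γ t : ℝ) (x : EuclideanSpace ℝ (Fin d)) : ℝ :=
  if γ = 0 then q H p t x else ∫ s in Ioi (0 : ℝ), s ^ γ * fH H s x * p t s

end StableTimeFBM

end

/-! ### Fourier representation of the stable density and its derivatives. -/

noncomputable section

namespace StableTimeFBM

/-! Put α = β/2 = 1/(2m). Fourier inversion gives p_t(s) = (1/π) Re ∫₀^∞ e^{-iξs} exp(-t(-iξ)^α) dξ.
A time derivative multiplies the integrand by -(-iξ)^α, a space derivative by -iξ. Since 2mα = 1 and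
2m is even, the 2m-th power of the first factor is the second: ∂_t^{2m} p = ∂_s p. This is the index
shift in `hasDerivAt_stableDens_space`.

The Gaussian density satisfies the heat equation in the variance v = s^{2H}, hence ∂_s f^H = H
s^{2H-1} Δ f^H. Differentiating q under the integral and integrating by parts in s
(`integral_mul_stableDens_eq_neg`), ∂_t^{2m} q = ∫ f^H ∂_s p ds = -∫ (∂_s f^H) p ds = -H Δ
V_{2H-1,t} q.

The analytic difficulty is the singularity of f^H and its derivatives at s = 0, which is at worst a
power of s. The density is smooth in s and vanishes on the negative axis, so it and all its time
derivatives vanish to infinite order at 0 (`abs_stableDens_le_pow`). At infinity they are O(1/s) by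
one integration by parts in ξ (`mul_norm_stableInt_le`), which suffices against strictly negative
powers of s.

On the probabilistic side, the Laplace transform is continued analytically to the imaginary axis
(`charFun_of_laplace`) and inverted (`eq_withDensity_of_laplace`). The law of W(Y(t)) is found by
comparing characteristic functions (`map_comp_subordinator`). -/

/-- The coefficient `-e^{-iπα/2}`, so that `stableCoeff α * ξ ^ α = -(-iξ)^α` for `ξ > 0`. -/
def stableCoeff (α : ℝ) : ℂ := -Complex.exp (-(Real.pi * α / 2 : ℝ) * Complex.I)

/-- The real number `cos (πα/2) = -Re (stableCoeff α)`. -/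
def stableRate (α : ℝ) : ℝ := Real.cos (Real.pi * α / 2)

/-- The integrand in the Fourier representation of the `k`-th time derivative of the density of a
stable subordinator of index `α`. -/
def stableKer (α : ℝ) (k : ℕ) (t s ξ : ℝ) : ℂ :=
  Complex.exp (-(ξ * s : ℝ) * Complex.I) * (stableCoeff α * (ξ ^ α : ℝ)) ^ k *
    Complex.exp (t * (stableCoeff α * (ξ ^ α : ℝ)))

/-- The half-line Fourier integral of `stableKer`. -/
def stableInt (α : ℝ) (k : ℕ) (t s : ℝ) : ℂ := ∫ ξ in Ioi (0 : ℝ), stableKer α k t s ξ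

/-- The `k`-th time derivative of the density at `s` of a stable subordinator of index `α` at
time `t`. -/
def stableDens (α : ℝ) (k : ℕ) (t s : ℝ) : ℝ := (1 / Real.pi) * (stableInt α k t s).re

variable {α : ℝ}

lemma norm_stableCoeff (α : ℝ) : ‖stableCoeff α‖ = 1 := by
  rw [stableCoeff, norm_neg]
  simpa using Complex.norm_exp_ofReal_mul_I (-(Real.pi * α / 2))

lemma re_stableCoeff (α : ℝ) : (stableCoeff α).re = -stableRate α := by
  rw [stableCoeff, stableRate, Complex.neg_re, Complex.exp_re]
  simp

lemma stableRate_pos (h0 : 0 < α) (h1 : α < 1) : 0 < stableRate α := by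
  apply Real.cos_pos_of_mem_Ioo
  constructor <;> nlinarith [Real.pi_pos]

/-- The source of the order 2m: the even power removes the minus sign, and e^{-iπα/2} raised to the
power 2m = 1/α is e^{-iπ/2}. -/
lemma stableCoeff_pow {m : ℕ} (hα : α * (2 * m) = 1) : stableCoeff α ^ (2 * m) = -Complex.I := by
  rw [stableCoeff, pow_mul, neg_sq, ← pow_mul, ← Complex.exp_nat_mul]
  have : ((2 * m : ℕ) : ℂ) * (-((Real.pi * α / 2 : ℝ) : ℂ) * Complex.I)
      = -(Real.pi / 2 * Complex.I) := by
    have h : ((α * (2 * m) : ℝ) : ℂ) = 1 := by rw [hα]; simp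
    push_cast at h ⊢
    linear_combination (-(Real.pi : ℂ) / 2 * Complex.I) * h
  rw [this, Complex.exp_neg, Complex.exp_pi_div_two_mul_I, Complex.inv_I]

lemma norm_stableKer (α : ℝ) (k : ℕ) (t s : ℝ) {ξ : ℝ} (hξ : 0 ≤ ξ) :
    ‖stableKer α k t s ξ‖ = (ξ ^ α) ^ k * Real.exp (-(t * stableRate α) * ξ ^ α) := by
  have h : ‖Complex.exp (-((ξ * s : ℝ) : ℂ) * Complex.I)‖ = 1 := by
    simpa using Complex.norm_exp_ofReal_mul_I (-(ξ * s))
  rw [stableKer, norm_mul, norm_mul, h, norm_pow, norm_mul, norm_stableCoeff, Complex.norm_real,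
    Real.norm_of_nonneg (Real.rpow_nonneg hξ _), Complex.norm_exp]
  simp [re_stableCoeff]
  left
  ring

lemma integrableOn_rpow_mul_stable (h0 : 0 < α) {b : ℝ} (hb : 0 < b) (k : ℕ) :
    IntegrableOn (fun ξ : ℝ => (ξ ^ α) ^ k * Real.exp (-b * ξ ^ α)) (Ioi 0) := by
  have h := integrableOn_rpow_mul_exp_neg_mul_rpow (s := α * k) (p := α) (b := b)
    (by have : 0 ≤ α * k := by positivity
        linarith) h0 hb
  refine h.congr_fun (fun ξ hξ => ?_) measurableSet_Ioi
  simp only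
  rw [Real.rpow_mul (le_of_lt hξ), Real.rpow_natCast]

lemma measurable_stableKer (α : ℝ) (k : ℕ) (t s : ℝ) : Measurable (stableKer α k t s) := by
  unfold stableKer
  fun_prop

lemma integrableOn_stableKer (h0 : 0 < α) (h1 : α < 1) (k : ℕ) {t : ℝ} (ht : 0 < t) (s : ℝ) :
    IntegrableOn (stableKer α k t s) (Ioi 0) := by
  refine (integrableOn_rpow_mul_stable h0 (mul_pos ht (stableRate_pos h0 h1)) k).mono'
    (measurable_stableKer α k t s).aestronglyMeasurable ?_
  filter_upwards [ae_restrict_mem measurableSet_Ioi] with ξ hξ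
  rw [norm_stableKer α k t s (le_of_lt hξ)]

/-- Dominating constant for `stableInt α k`. -/
def stableBound (α : ℝ) (k : ℕ) (t : ℝ) : ℝ :=
  ∫ ξ in Ioi (0 : ℝ), (ξ ^ α) ^ k * Real.exp (-(t * stableRate α) * ξ ^ α)

lemma norm_stableKer_le (h0 : 0 < α) (h1 : α < 1) (k : ℕ) {t₀ t : ℝ} (htt : t₀ ≤ t) (s : ℝ)
    {ξ : ℝ} (hξ : 0 ≤ ξ) :
    ‖stableKer α k t s ξ‖ ≤ (ξ ^ α) ^ k * Real.exp (-(t₀ * stableRate α) * ξ ^ α) := by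
  rw [norm_stableKer α k t s hξ]
  have := stableRate_pos h0 h1
  have := Real.rpow_nonneg hξ α
  gcongr

lemma norm_stableInt_le (h0 : 0 < α) (h1 : α < 1) (k : ℕ) {t₀ t : ℝ} (ht₀ : 0 < t₀) (htt : t₀ ≤ t)
    (s : ℝ) : ‖stableInt α k t s‖ ≤ stableBound α k t₀ := by
  refine norm_integral_le_of_norm_le
    (integrableOn_rpow_mul_stable h0 (mul_pos ht₀ (stableRate_pos h0 h1)) k) ?_
  filter_upwards [ae_restrict_mem measurableSet_Ioi] with ξ hξ
  exact norm_stableKer_le h0 h1 k htt s (le_of_lt hξ)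

lemma hasDerivAt_stableKer_time (α : ℝ) (k : ℕ) (t s ξ : ℝ) :
    HasDerivAt (fun τ => stableKer α k τ s ξ) (stableKer α (k + 1) t s ξ) t := by
  unfold stableKer
  have h : HasDerivAt (fun τ : ℝ => Complex.exp (τ * (stableCoeff α * (ξ ^ α : ℝ))))
      (Complex.exp (t * (stableCoeff α * (ξ ^ α : ℝ))) * (1 * (stableCoeff α * (ξ ^ α : ℝ)))) t :=
    ((hasDerivAt_id t).ofReal_comp.mul_const _).cexp
  refine (h.const_mul (Complex.exp (-(ξ * s : ℝ) * Complex.I) *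
    (stableCoeff α * (ξ ^ α : ℝ)) ^ k)).congr_deriv ?_
  ring

/-- Differentiating e^{-iξs} produces -iξ, which is the 2m-th power of the factor produced by one
time derivative. This is the pointwise form of ∂_s = ∂_t^{2m}. -/
lemma hasDerivAt_stableKer_space {m : ℕ} (hα : α * (2 * m) = 1) (k : ℕ) (t s : ℝ) {ξ : ℝ}
    (hξ : 0 ≤ ξ) :
    HasDerivAt (fun σ => stableKer α k t σ ξ) (stableKer α (k + 2 * m) t s ξ) s := by
  unfold stableKer
  have h : HasDerivAt (fun σ : ℝ => Complex.exp (-(ξ * σ : ℝ) * Complex.I))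
      (Complex.exp (-(ξ * s : ℝ) * Complex.I) * (-((ξ * 1 : ℝ) : ℂ) * Complex.I)) s :=
    ((((hasDerivAt_id s).const_mul ξ).ofReal_comp.neg).mul_const _).cexp
  refine ((h.mul_const ((stableCoeff α * (ξ ^ α : ℝ)) ^ k)).mul_const
    (Complex.exp (t * (stableCoeff α * (ξ ^ α : ℝ))))).congr_deriv ?_
  have e : ((ξ ^ α : ℝ) : ℂ) ^ (2 * m) = ξ := by
    rw [← Complex.ofReal_pow, ← Real.rpow_natCast, ← Real.rpow_mul hξ]
    push_cast
    rw [hα, Real.rpow_one]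
  rw [pow_add, mul_pow _ _ (2 * m), stableCoeff_pow hα, e]
  push_cast
  ring

lemma hasDerivAt_stableInt_time (h0 : 0 < α) (h1 : α < 1) (k : ℕ) {t : ℝ} (ht : 0 < t) (s : ℝ) :
    HasDerivAt (fun τ => stableInt α k τ s) (stableInt α (k + 1) t s) t := by
  unfold stableInt
  -- For times above t/2 the exponential factor at time t/2 dominates, which gives one integrable
  -- majorant.
  refine (hasDerivAt_integral_of_dominated_loc_of_deriv_le
    (F' := fun τ => stableKer α (k + 1) τ s) (Ioi_mem_nhds (half_lt_self ht))
    (Eventually.of_forall fun τ => (measurable_stableKer α k τ s).aestronglyMeasurable)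
    (integrableOn_stableKer h0 h1 k ht s)
    (measurable_stableKer α (k + 1) t s).aestronglyMeasurable ?_
    (integrableOn_rpow_mul_stable h0 (mul_pos (half_pos ht) (stableRate_pos h0 h1)) (k + 1)) ?_).2
  · filter_upwards [ae_restrict_mem measurableSet_Ioi] with ξ hξ τ hτ
    exact norm_stableKer_le h0 h1 (k + 1) (le_of_lt hτ) s (le_of_lt hξ)
  · filter_upwards with ξ τ _
    exact hasDerivAt_stableKer_time α k τ s ξ

lemma hasDerivAt_stableInt_space (h0 : 0 < α) (h1 : α < 1) {m : ℕ} (hα : α * (2 * m) = 1) (k : ℕ)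
    {t : ℝ} (ht : 0 < t) (s : ℝ) :
    HasDerivAt (fun σ => stableInt α k t σ) (stableInt α (k + 2 * m) t s) s := by
  unfold stableInt
  refine (hasDerivAt_integral_of_dominated_loc_of_deriv_le
    (F' := fun σ => stableKer α (k + 2 * m) t σ) (s := univ) univ_mem
    (Eventually.of_forall fun τ => (measurable_stableKer α k t τ).aestronglyMeasurable)
    (integrableOn_stableKer h0 h1 k ht s)
    (measurable_stableKer α (k + 2 * m) t s).aestronglyMeasurable ?_
    (integrableOn_rpow_mul_stable h0 (mul_pos ht (stableRate_pos h0 h1)) (k + 2 * m)) ?_).2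
  · filter_upwards [ae_restrict_mem measurableSet_Ioi] with ξ hξ τ hτ
    exact norm_stableKer_le h0 h1 _ le_rfl τ (le_of_lt hξ)
  · filter_upwards [ae_restrict_mem measurableSet_Ioi] with ξ hξ σ _
    exact hasDerivAt_stableKer_space hα k t σ (le_of_lt hξ)

lemma hasDerivAt_stableDens_time (h0 : 0 < α) (h1 : α < 1) (k : ℕ) {t : ℝ} (ht : 0 < t) (s : ℝ) :
    HasDerivAt (fun τ => stableDens α k τ s) (stableDens α (k + 1) t s) t :=
  (Complex.reCLM.hasFDerivAt.comp_hasDerivAt t (hasDerivAt_stableInt_time h0 h1 k ht s)).const_mul _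

lemma hasDerivAt_stableDens_space (h0 : 0 < α) (h1 : α < 1) {m : ℕ} (hα : α * (2 * m) = 1) (k : ℕ)
    {t : ℝ} (ht : 0 < t) (s : ℝ) :
    HasDerivAt (fun σ => stableDens α k t σ) (stableDens α (k + 2 * m) t s) s :=
  (Complex.reCLM.hasFDerivAt.comp_hasDerivAt s
    (hasDerivAt_stableInt_space h0 h1 hα k ht s)).const_mul _

lemma abs_stableDens_le_norm (k : ℕ) (t s : ℝ) :
    |stableDens α k t s| ≤ ‖stableInt α k t s‖ := by
  rw [stableDens, abs_mul, abs_of_pos (by positivity)]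
  have h1 : 1 / Real.pi ≤ 1 := by
    rw [div_le_one Real.pi_pos]
    linarith [Real.pi_gt_three]
  calc 1 / Real.pi * |(stableInt α k t s).re| ≤ 1 * |(stableInt α k t s).re| := by gcongr
    _ ≤ ‖stableInt α k t s‖ := by rw [one_mul]; exact Complex.abs_re_le_norm _

lemma abs_stableDens_le (h0 : 0 < α) (h1 : α < 1) (k : ℕ) {t₀ t : ℝ} (ht₀ : 0 < t₀) (htt : t₀ ≤ t)
    (s : ℝ) : |stableDens α k t s| ≤ stableBound α k t₀ :=
  (abs_stableDens_le_norm k t s).trans (norm_stableInt_le h0 h1 k ht₀ htt s)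

/-- The majorant of the `ξ`-derivative of the amplitude of `stableKer`. -/
def stableAmpDeriv (α : ℝ) (k : ℕ) (t₀ t₁ ξ : ℝ) : ℝ :=
  (k * (ξ ^ α) ^ (k - 1) + t₁ * (ξ ^ α) ^ k) * Real.exp (-(t₀ * stableRate α) * ξ ^ α) *
    (α * ξ ^ (α - 1))

lemma integrableOn_stableAmpDeriv (h0 : 0 < α) (h1 : α < 1) (k : ℕ) {t₀ : ℝ} (ht₀ : 0 < t₀)
    (t₁ : ℝ) : IntegrableOn (stableAmpDeriv α k t₀ t₁) (Ioi 0) := by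
  have key : ∀ n : ℕ, IntegrableOn (fun ξ : ℝ => (ξ ^ α) ^ n *
      Real.exp (-(t₀ * stableRate α) * ξ ^ α) * ξ ^ (α - 1)) (Ioi 0) := by
    intro n
    have h := integrableOn_rpow_mul_exp_neg_mul_rpow (s := α * n + (α - 1)) (p := α)
      (b := t₀ * stableRate α)
      (by have : 0 ≤ α * n := by positivity
          linarith) h0 (mul_pos ht₀ (stableRate_pos h0 h1))
    refine h.congr_fun (fun ξ hξ => ?_) measurableSet_Ioi
    simp only
    rw [Real.rpow_add hξ, Real.rpow_mul (le_of_lt hξ), Real.rpow_natCast]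
    ring
  have h := ((key (k - 1)).const_mul (k * α)).add ((key k).const_mul (t₁ * α))
  refine IntegrableOn.congr_fun h (fun ξ _ => ?_) measurableSet_Ioi
  simp only [stableAmpDeriv, Pi.add_apply]
  ring

/-- Integration by parts in the Fourier representation: decay in the space variable. -/
lemma mul_norm_stableInt_le (h0 : 0 < α) (h1 : α < 1) (k : ℕ) {t₀ t₁ t : ℝ} (ht₀ : 0 < t₀)
    (htt : t₀ ≤ t) (htt1 : t ≤ t₁) {s : ℝ} (hs : 0 ≤ s) :
    s * ‖stableInt α k t s‖ ≤ 1 + ∫ ξ in Ioi (0 : ℝ), stableAmpDeriv α k t₀ t₁ ξ := by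
  have ht : 0 < t := ht₀.trans_le htt
  have hb := stableRate_pos h0 h1
  set c := stableCoeff α with hc
  -- `G'` collects the terms in which the derivative falls on the amplitude rather than on e^{-iξs}.
  -- The truncated exponent k - 1 is harmless at k = 0 because of the factor k, and the singularity
  -- ξ^{α-1} at 0 is integrable.
  set G' : ℝ → ℂ := fun ξ => Complex.exp (-(ξ * s : ℝ) * Complex.I) *
    ((k * (c * (ξ ^ α : ℝ)) ^ (k - 1) * c + t * c * (c * (ξ ^ α : ℝ)) ^ k) *
    Complex.exp (t * (c * (ξ ^ α : ℝ))) * ((α * ξ ^ (α - 1) : ℝ) : ℂ)) with hG'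
  have hder : ∀ ξ ∈ Ioi (0 : ℝ), HasDerivAt (stableKer α k t s)
      (-(s * Complex.I) * stableKer α k t s ξ + G' ξ) ξ := by
    intro ξ hξ
    have e1 : HasDerivAt (fun ξ : ℝ => Complex.exp (-(ξ * s : ℝ) * Complex.I))
        (Complex.exp (-(ξ * s : ℝ) * Complex.I) * (-((1 * s : ℝ) : ℂ) * Complex.I)) ξ :=
      ((((hasDerivAt_id ξ).mul_const s).ofReal_comp.neg).mul_const _).cexp
    have e2 : HasDerivAt (fun ξ : ℝ => c * ((ξ ^ α : ℝ) : ℂ)) (c * ((α * ξ ^ (α - 1) : ℝ) : ℂ)) ξ :=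
      (Real.hasDerivAt_rpow_const (Or.inl (ne_of_gt hξ))).ofReal_comp.const_mul c
    have := (e1.mul (e2.pow k)).mul ((e2.const_mul (t : ℂ)).cexp)
    refine this.congr_deriv ?_
    simp only [hG', stableKer, ← hc, Pi.mul_apply, Pi.pow_apply]
    push_cast
    ring
  have hG'm : Measurable G' := by
    simp only [hG']
    fun_prop
  have hG'le : ∀ ξ ∈ Ioi (0 : ℝ), ‖G' ξ‖ ≤ stableAmpDeriv α k t₀ t₁ ξ := by
    intro ξ hξ
    have hξ' : 0 < ξ := hξ
    have hy : 0 ≤ ξ ^ α := Real.rpow_nonneg hξ'.le _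
    have hy' : 0 ≤ ξ ^ (α - 1) := Real.rpow_nonneg hξ'.le _
    have n1 : ‖Complex.exp (-((ξ * s : ℝ) : ℂ) * Complex.I)‖ = 1 := by
      simpa using Complex.norm_exp_ofReal_mul_I (-(ξ * s))
    have n2 : ‖Complex.exp (t * (c * (ξ ^ α : ℝ)))‖ = Real.exp (-(t * stableRate α) * ξ ^ α) := by
      rw [Complex.norm_exp]
      congr 1
      simp [hc, re_stableCoeff]
      ring
    have n3 : ‖(k * (c * (ξ ^ α : ℝ)) ^ (k - 1) * c + t * c * (c * (ξ ^ α : ℝ)) ^ k : ℂ)‖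
        ≤ k * (ξ ^ α) ^ (k - 1) + t * (ξ ^ α) ^ k := by
      refine (norm_add_le _ _).trans (le_of_eq ?_)
      simp only [norm_mul, norm_pow, hc, norm_stableCoeff, Complex.norm_real, Complex.norm_natCast,
        Real.norm_of_nonneg hy, Real.norm_of_nonneg ht.le]
      ring
    rw [hG', norm_mul, norm_mul, norm_mul, n1, n2, one_mul, Complex.norm_real,
      Real.norm_of_nonneg (by positivity), stableAmpDeriv]
    have : 0 ≤ t₁ := ht.le.trans htt1
    gcongr
    exact n3.trans (by gcongr)
  have hG'int : IntegrableOn G' (Ioi 0) := by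
    refine (integrableOn_stableAmpDeriv h0 h1 k ht₀ t₁).mono' hG'm.aestronglyMeasurable ?_
    filter_upwards [ae_restrict_mem measurableSet_Ioi] with ξ hξ using hG'le ξ hξ
  have hKint := integrableOn_stableKer h0 h1 k ht s
  have hcont : ContinuousWithinAt (stableKer α k t s) (Ici 0) 0 := by
    have : Continuous fun ξ : ℝ => ξ ^ α := Real.continuous_rpow_const h0.le
    have : Continuous (stableKer α k t s) := by
      unfold stableKer
      fun_prop
    exact this.continuousWithinAt
  have hlim : Tendsto (stableKer α k t s) atTop (𝓝 0) := by
    rw [tendsto_zero_iff_norm_tendsto_zero]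
    have hr : 0 < t * stableRate α := mul_pos ht hb
    have e : Tendsto (fun y : ℝ => y ^ k * Real.exp (-(t * stableRate α) * y)) atTop (𝓝 0) := by
      have := tendsto_rpow_mul_exp_neg_mul_atTop_nhds_zero k (t * stableRate α) hr
      simpa using this
    refine (e.comp (tendsto_rpow_atTop h0)).congr' ?_
    filter_upwards [eventually_ge_atTop 0] with ξ hξ
    rw [norm_stableKer α k t s hξ]
    rfl
  have hFTC := integral_Ioi_of_hasDerivAt_of_tendsto hcont hder
    ((hKint.const_mul _).add hG'int) hlim
  rw [integral_add (hKint.const_mul _) hG'int, integral_const_mul] at hFTC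
  -- The boundary term at ξ = 0 equals 0^k in norm, that is 1 for k = 0 and 0 otherwise; hence the
  -- constant 1 in the bound.
  have hval : ‖stableKer α k t s 0‖ ≤ 1 := by
    rw [norm_stableKer α k t s le_rfl, Real.zero_rpow h0.ne', mul_zero, Real.exp_zero, mul_one]
    rcases k with _ | k <;> simp
  have hn : s * ‖stableInt α k t s‖ = ‖-((s : ℂ) * Complex.I) * stableInt α k t s‖ := by
    rw [norm_mul, norm_neg, norm_mul, Complex.norm_real, Real.norm_of_nonneg hs, Complex.norm_I,
      mul_one]
  have heq : -((s : ℂ) * Complex.I) * stableInt α k t s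
      = -stableKer α k t s 0 - ∫ ξ in Ioi (0 : ℝ), G' ξ := by
    rw [stableInt]
    linear_combination hFTC
  rw [hn, heq]
  refine (norm_sub_le _ _).trans (add_le_add (by rwa [norm_neg]) ?_)
  refine norm_integral_le_of_norm_le (integrableOn_stableAmpDeriv h0 h1 k ht₀ t₁) ?_
  filter_upwards [ae_restrict_mem measurableSet_Ioi] with ξ hξ using hG'le ξ hξ

end StableTimeFBM

end

/-! ### From the Laplace transform to the density by Fourier inversion. -/

noncomputable section

namespace StableTimeFBM

open scoped FourierTransform SchwartzMap

/-- Fourier inversion for a finite measure with integrable characteristic function, tested against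
Schwartz functions. -/
lemma integral_schwartz_eq_of_integrable_charFun (ν : Measure ℝ) [IsFiniteMeasure ν]
    (hint : Integrable (fun x : ℝ => charFun ν (2 * Real.pi * x))) (f : 𝓢(ℝ, ℂ)) :
    ∫ y, f y ∂ν = ∫ s, f s * 𝓕 (fun x : ℝ => charFun ν (2 * Real.pi * x)) s := by
  have hF : Integrable (𝓕 (f : ℝ → ℂ)) := by
    rw [← SchwartzMap.fourier_coe]
    exact (𝓕 f).integrable
  have hinv : 𝓕⁻ (𝓕 (f : ℝ → ℂ)) = f :=
    f.continuous.fourierInv_fourier_eq f.integrable hF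
  -- Two applications of the duality formula for the Fourier transform. With the sign of the pairing
  -- reversed, the first turns the inverse transform of f̂, integrated against ν, into f̂ integrated
  -- against the characteristic function; the second moves the transform from f onto that function.
  have e1 := VectorFourier.integral_fourierIntegral_smul_eq_flip (e := Real.fourierChar)
    (μ := volume) (ν := ν) (L := -innerₗ ℝ) (f := 𝓕 (f : ℝ → ℂ)) (g := fun _ => (1 : ℂ))
    Real.continuous_fourierChar (by exact continuous_inner.neg) hF (integrable_const _)
  have e2 := VectorFourier.integral_fourierIntegral_smul_eq_flip (e := Real.fourierChar)
    (μ := volume) (ν := volume) (L := innerₗ ℝ) (f := (f : ℝ → ℂ))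
    (g := fun x : ℝ => charFun ν (2 * Real.pi * x))
    Real.continuous_fourierChar continuous_inner f.integrable hint
  have h1 : ∀ y, VectorFourier.fourierIntegral Real.fourierChar volume (-innerₗ ℝ)
      (𝓕 (f : ℝ → ℂ)) y = f y := by
    intro y
    have e := congrFun hinv y
    rw [Real.fourierInv_eq] at e
    rw [← e, VectorFourier.fourierIntegral]
    simp
  have h2 : ∀ x, VectorFourier.fourierIntegral Real.fourierChar ν (-innerₗ ℝ).flip
      (fun _ => (1 : ℂ)) x = charFun ν (2 * Real.pi * x) := by
    intro x
    rw [charFun_apply_real, VectorFourier.fourierIntegral]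
    congr 1
    ext y
    simp [Circle.smul_def, Real.fourierChar_apply]
    congr 1
    ring
  simp only [h1, h2, smul_eq_mul, mul_one] at e1
  rw [e1]
  refine Eq.trans ?_ (e2.trans ?_)
  · rfl
  · have h3 : (innerₗ ℝ).flip = innerₗ ℝ := by
      ext
      simp
    rw [h3]
    rfl

/-- A smooth approximation from below of the indicator function of `(a, b)`. -/
def smoothIoo (a b : ℝ) (n : ℕ) (x : ℝ) : ℝ :=
  Real.smoothTransition (n * (x - a)) * Real.smoothTransition (n * (b - x))

lemma contDiff_smoothIoo (a b : ℝ) (n : ℕ) : ContDiff ℝ (⊤ : ℕ∞) (smoothIoo a b n) :=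
  (Real.smoothTransition.contDiff.comp (by fun_prop)).mul
    (Real.smoothTransition.contDiff.comp (by fun_prop))

lemma smoothIoo_eq_zero {a b x : ℝ} (n : ℕ) (hx : x ∉ Ioo a b) : smoothIoo a b n x = 0 := by
  rw [mem_Ioo, not_and_or, not_lt, not_lt] at hx
  rcases hx with hx | hx
  · rw [smoothIoo, Real.smoothTransition.zero_of_nonpos, zero_mul]
    exact mul_nonpos_of_nonneg_of_nonpos n.cast_nonneg (by linarith)
  · rw [smoothIoo, mul_comm, Real.smoothTransition.zero_of_nonpos, zero_mul]
    exact mul_nonpos_of_nonneg_of_nonpos n.cast_nonneg (by linarith)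

lemma abs_smoothIoo_le (a b : ℝ) (n : ℕ) (x : ℝ) : |smoothIoo a b n x| ≤ 1 := by
  rw [smoothIoo, abs_mul, abs_of_nonneg (Real.smoothTransition.nonneg _),
    abs_of_nonneg (Real.smoothTransition.nonneg _)]
  exact mul_le_one₀ (Real.smoothTransition.le_one _) (Real.smoothTransition.nonneg _)
    (Real.smoothTransition.le_one _)

lemma tendsto_smoothIoo (a b x : ℝ) :
    Tendsto (fun n => smoothIoo a b n x) atTop (𝓝 ((Ioo a b).indicator 1 x)) := by
  by_cases hx : x ∈ Ioo a b
  · rw [indicator_of_mem hx]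
    have h1 : ∀ c : ℝ, 0 < c → ∀ᶠ n : ℕ in atTop, 1 ≤ n * c := by
      intro c hc
      filter_upwards [(tendsto_natCast_atTop_atTop (R := ℝ)).eventually_ge_atTop (1 / c)] with n hn
      rwa [div_le_iff₀ hc] at hn
    refine tendsto_const_nhds.congr' ?_
    filter_upwards [h1 _ (sub_pos.2 hx.1), h1 _ (sub_pos.2 hx.2)] with n h h'
    rw [smoothIoo, Real.smoothTransition.one_of_one_le h, Real.smoothTransition.one_of_one_le h']
    simp
  · rw [indicator_of_notMem hx]
    exact tendsto_const_nhds.congr fun n => (smoothIoo_eq_zero n hx).symm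

lemma hasCompactSupport_smoothIoo (a b : ℝ) (n : ℕ) : HasCompactSupport (smoothIoo a b n) :=
  HasCompactSupport.intro (isCompact_Icc (a := a) (b := b)) fun _ hx =>
    smoothIoo_eq_zero n fun h => hx (Ioo_subset_Icc_self h)

/-- A finite measure on the line which integrates Schwartz functions like a continuous real density
is that density. -/
lemma eq_withDensity_of_integral_schwartz (ν : Measure ℝ) [IsFiniteMeasure ν] {P : ℝ → ℝ}
    (hP : Continuous P)
    (h : ∀ f : 𝓢(ℝ, ℂ), ∫ y, f y ∂ν = ∫ s, f s * (P s : ℂ)) :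
    (∀ s, 0 ≤ P s) ∧ ν = volume.withDensity (fun s => ENNReal.ofReal (P s)) := by
  have h1 : ∀ (a b : ℝ) (n : ℕ),
      ∫ y, smoothIoo a b n y ∂ν = ∫ s, smoothIoo a b n s * P s := by
    intro a b n
    have hc : HasCompactSupport (fun x => (smoothIoo a b n x : ℂ)) :=
      (hasCompactSupport_smoothIoo a b n).comp_left Complex.ofReal_zero
    have hd : ContDiff ℝ (⊤ : ℕ∞) (fun x => (smoothIoo a b n x : ℂ)) :=
      Complex.ofRealCLM.contDiff.comp (contDiff_smoothIoo a b n)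
    have : ∫ y, (smoothIoo a b n y : ℂ) ∂ν = ∫ s, (smoothIoo a b n s : ℂ) * (P s : ℂ) :=
      h (hc.toSchwartzMap hd)
    simp only [← Complex.ofReal_mul] at this
    rw [integral_complex_ofReal, integral_complex_ofReal] at this
    exact_mod_cast this
  have h2 : ∀ a b : ℝ, ν.real (Ioo a b) = ∫ s in Ioo a b, P s := by
    intro a b
    have l1 : Tendsto (fun n => ∫ y, smoothIoo a b n y ∂ν) atTop
        (𝓝 (∫ y, (Ioo a b).indicator 1 y ∂ν)) :=
      tendsto_integral_of_dominated_convergence (fun _ => 1)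
        (fun n => (contDiff_smoothIoo a b n).continuous.aestronglyMeasurable) (integrable_const _)
        (fun n => Eventually.of_forall fun x => abs_smoothIoo_le a b n x)
        (Eventually.of_forall fun x => tendsto_smoothIoo a b x)
    have l2 : Tendsto (fun n => ∫ s, smoothIoo a b n s * P s) atTop
        (𝓝 (∫ s, (Ioo a b).indicator 1 s * P s)) := by
      refine tendsto_integral_of_dominated_convergence ((Ioo a b).indicator fun s => |P s|)
        (fun n => ((contDiff_smoothIoo a b n).continuous.mul hP).aestronglyMeasurable)
        ?_ (fun n => Eventually.of_forall fun x => ?_)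
        (Eventually.of_forall fun x => (tendsto_smoothIoo a b x).mul_const _)
      · rw [integrable_indicator_iff measurableSet_Ioo]
        exact (hP.abs.continuousOn.integrableOn_Icc).mono_set Ioo_subset_Icc_self
      · by_cases hx : x ∈ Ioo a b
        · rw [indicator_of_mem hx, Real.norm_eq_abs, abs_mul]
          exact mul_le_of_le_one_left (abs_nonneg _) (abs_smoothIoo_le a b n x)
        · rw [indicator_of_notMem hx, smoothIoo_eq_zero n hx, zero_mul, norm_zero]
    simp only [h1] at l1
    have := tendsto_nhds_unique l1 l2
    rw [integral_indicator_one measurableSet_Ioo] at this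
    rw [this, ← integral_indicator measurableSet_Ioo]
    congr 1
    ext s
    by_cases hs : s ∈ Ioo a b <;> simp [hs]
  -- A negative value of P would persist on an interval by continuity and give that interval
  -- negative ν-measure.
  have hnn : ∀ s, 0 ≤ P s := by
    intro s
    by_contra! hs
    have hev : ∀ᶠ u in 𝓝 s, P u < P s / 2 :=
      hP.continuousAt.eventually_lt continuousAt_const (by linarith)
    obtain ⟨ε, hε, hb⟩ := Metric.eventually_nhds_iff_ball.1 hev
    rw [Real.ball_eq_Ioo] at hb
    have hle : ∫ u in Ioo (s - ε) (s + ε), P u ≤ ∫ u in Ioo (s - ε) (s + ε), P s / 2 :=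
      setIntegral_mono_on ((hP.continuousOn.integrableOn_Icc).mono_set Ioo_subset_Icc_self)
        (by simp) measurableSet_Ioo fun u hu => (hb u hu).le
    rw [← h2, setIntegral_const, smul_eq_mul, Real.volume_real_Ioo_of_le (by linarith)] at hle
    have : 0 ≤ ν.real (Ioo (s - ε) (s + ε)) := measureReal_nonneg
    nlinarith
  refine ⟨hnn, Real.measure_ext_Ioo_rat fun a b => ?_⟩
  rw [withDensity_apply _ measurableSet_Ioo, ← ofReal_integral_eq_lintegral_ofReal
    ((hP.continuousOn.integrableOn_Icc).mono_set Ioo_subset_Icc_self)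
    (Eventually.of_forall hnn), ← h2, measureReal_def, ENNReal.ofReal_toReal (measure_ne_top _ _)]

variable {α : ℝ}

/-- The characteristic function of a one-sided stable law, from its Laplace transform. -/
lemma charFun_of_laplace {t : ℝ} (ν : Measure ℝ)
    [IsProbabilityMeasure ν] (hpos : ∀ᵐ y ∂ν, 0 ≤ y)
    (hL : ∀ l : ℝ, 0 ≤ l → ∫ y, Real.exp (-l * y) ∂ν = Real.exp (-t * l ^ α))
    {ξ : ℝ} (hξ : 0 < ξ) :
    charFun ν ξ = Complex.exp (t * (stableCoeff α * (ξ ^ α : ℝ))) := by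
  -- `g` continues the Laplace transform, read at l = -z, to the half-plane Re z < 0. It agrees with
  -- the complex moment generating function on the negative reals, hence on the half-plane by the
  -- identity theorem; then z tends to iξ along -ε + iξ.
  set g : ℂ → ℂ := fun z => Complex.exp (-t * (-z) ^ (α : ℂ)) with hg
  have hset : {z : ℂ | z.re < 0} ⊆ {z | z.re ∈ interior (integrableExpSet id ν)} := by
    intro z hz
    refine mem_interior.2 ⟨Iio 0, fun x hx => ?_, isOpen_Iio, hz⟩
    refine (integrable_const (1 : ℝ)).mono' (by fun_prop) ?_
    filter_upwards [hpos] with y hy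
    rw [Real.norm_of_nonneg (Real.exp_nonneg _), Real.exp_le_one_iff]
    exact mul_nonpos_of_nonpos_of_nonneg (le_of_lt hx) hy
  have han : AnalyticOnNhd ℂ (complexMGF id ν) {z : ℂ | z.re < 0} :=
    analyticOnNhd_complexMGF.mono hset
  have hopen : IsOpen {z : ℂ | z.re < 0} := isOpen_lt Complex.continuous_re continuous_const
  have hgan : AnalyticOnNhd ℂ g {z : ℂ | z.re < 0} := by
    refine DifferentiableOn.analyticOnNhd (fun z hz => ?_) hopen
    have hslit : -z ∈ Complex.slitPlane := Or.inl (by simpa using hz)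
    exact (((differentiableAt_id.neg).cpow_const hslit).const_mul _).cexp.differentiableWithinAt
  have hreal : ∀ x : ℝ, x < 0 → complexMGF id ν x = g x := by
    intro x hx
    rw [complexMGF_ofReal, mgf]
    have := hL (-x) (by linarith)
    simp only [neg_neg] at this
    simp only [id, this, hg]
    rw [← Complex.ofReal_neg x, ← Complex.ofReal_cpow (by linarith)]
    push_cast
    rfl
  have hfreq : ∃ᶠ z in 𝓝[≠] (-1 : ℂ), complexMGF id ν z = g z := by
    have ht : Tendsto (fun x : ℝ => (x : ℂ)) (𝓝[≠] (-1 : ℝ)) (𝓝[≠] (-1 : ℂ)) := by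
      refine tendsto_nhdsWithin_iff.2 ⟨?_, ?_⟩
      · have := (Complex.continuous_ofReal.tendsto (-1 : ℝ)).mono_left
          (nhdsWithin_le_nhds (s := {(-1 : ℝ)}ᶜ))
        simpa using this
      · filter_upwards [self_mem_nhdsWithin] with x hx h
        apply hx
        have h' : (x : ℂ) = ((-1 : ℝ) : ℂ) := by simpa using h
        exact Complex.ofReal_injective h'
    have hev : ∀ᶠ x : ℝ in 𝓝[≠] (-1 : ℝ), complexMGF id ν x = g x := by
      filter_upwards [mem_nhdsWithin_of_mem_nhds (Iio_mem_nhds (show (-1 : ℝ) < 0 by norm_num))]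
        with x hx using hreal x hx
    exact ht.frequently hev.frequently
  have heq : EqOn (complexMGF id ν) g {z : ℂ | z.re < 0} :=
    han.eqOn_of_preconnected_of_frequently_eq hgan
      (convex_halfSpace_re_lt 0).isPreconnected (by simp) hfreq
  have hpath : ∀ᶠ ε : ℝ in 𝓝[>] 0, complexMGF id ν (-ε + ξ * Complex.I) =
      g (-ε + ξ * Complex.I) := by
    filter_upwards [self_mem_nhdsWithin] with ε hε
    exact heq (by simpa using hε)
  have hpt : Tendsto (fun ε : ℝ => (-ε + ξ * Complex.I : ℂ)) (𝓝[>] 0) (𝓝 (ξ * Complex.I)) := by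
    have : Continuous (fun ε : ℝ => (-ε + ξ * Complex.I : ℂ)) := by fun_prop
    simpa using (this.tendsto 0).mono_left (nhdsWithin_le_nhds (s := Ioi (0 : ℝ)))
  have hlim1 : Tendsto (fun ε : ℝ => complexMGF id ν (-ε + ξ * Complex.I)) (𝓝[>] 0)
      (𝓝 (complexMGF id ν (ξ * Complex.I))) := by
    unfold complexMGF
    refine tendsto_integral_filter_of_dominated_convergence (fun _ => 1)
      (Eventually.of_forall fun ε => by fun_prop) ?_ (integrable_const _)
      (Eventually.of_forall fun y => ?_)
    · filter_upwards [self_mem_nhdsWithin] with ε hε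
      filter_upwards [hpos] with y hy
      have hε' : 0 < ε := hε
      rw [Complex.norm_exp, Real.exp_le_one_iff]
      simp
      positivity
    · exact ((hpt.mul_const _).cexp)
  -- The limit point avoids the cut of the principal power because ξ ≠ 0, so `g` is continuous
  -- there.
  have hslit : -((ξ : ℂ) * Complex.I) ∈ Complex.slitPlane := Or.inr (by simpa using hξ.ne')
  have hlim2 : Tendsto (fun ε : ℝ => g (-ε + ξ * Complex.I)) (𝓝[>] 0)
      (𝓝 (g (ξ * Complex.I))) := by
    have hc : ContinuousAt g (ξ * Complex.I) :=
      (((differentiableAt_id.neg).cpow_const hslit).const_mul _).cexp.continuousAt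
    exact hc.tendsto.comp hpt
  have hfin : complexMGF id ν (ξ * Complex.I) = g (ξ * Complex.I) :=
    tendsto_nhds_unique (hlim1.congr' hpath) hlim2
  rw [complexMGF_id_mul_I] at hfin
  rw [hfin, hg]
  simp only
  congr 1
  have hcp : (-((ξ : ℂ) * Complex.I)) ^ (α : ℂ) = -(stableCoeff α * (ξ ^ α : ℝ)) := by
    have e : -((ξ : ℂ) * Complex.I) = (ξ : ℂ) * (-Complex.I) := by ring
    rw [e, Complex.cpow_def_of_ne_zero (by simp [hξ.ne']),
      Complex.log_ofReal_mul hξ (by simp), Complex.log_neg_I, add_mul, Complex.exp_add,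
      Complex.ofReal_cpow hξ.le, Complex.cpow_def_of_ne_zero (by simp [hξ.ne']),
      ← Complex.ofReal_log hξ.le, stableCoeff, mul_comm]
    simp only [neg_mul, neg_neg]
    congr 2
    push_cast
    ring
  rw [hcp]
  ring

/-- A probability measure on `[0, ∞)` with the Laplace transform `e^{-t l^α}` has the density
`stableDens α 0 t`. -/
lemma eq_withDensity_of_laplace (h0 : 0 < α) (h1 : α < 1) {t : ℝ} (ht : 0 < t) (ν : Measure ℝ)
    [IsProbabilityMeasure ν] (hpos : ∀ᵐ y ∂ν, 0 ≤ y)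
    (hL : ∀ l : ℝ, 0 ≤ l → ∫ y, Real.exp (-l * y) ∂ν = Real.exp (-t * l ^ α))
    (hcont : Continuous (stableDens α 0 t)) :
    (∀ s, 0 ≤ stableDens α 0 t s) ∧
      ν = volume.withDensity (fun s => ENNReal.ofReal (stableDens α 0 t s)) := by
  set ψ : ℝ → ℂ := fun x => charFun ν (2 * Real.pi * x) with hψ
  have h2π : (0 : ℝ) < 2 * Real.pi := by positivity
  have hker : ∀ s x : ℝ, 0 < x → Complex.exp ((-2 * Real.pi * x * s : ℝ) * Complex.I) * ψ x
      = stableKer α 0 t s (2 * Real.pi * x) := by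
    intro s x hx
    rw [hψ]
    simp only
    rw [charFun_of_laplace ν hpos hL (mul_pos h2π hx), stableKer, pow_zero, mul_one]
    congr 3
    push_cast
    ring
  have hneg : ∀ x, ψ (-x) = (starRingEnd ℂ) (ψ x) := by
    intro x
    simp only [hψ]
    rw [mul_neg, charFun_neg]
  have hI : ∀ s : ℝ, IntegrableOn
      (fun x : ℝ => Complex.exp ((-2 * Real.pi * x * s : ℝ) * Complex.I) * ψ x) (Ioi 0) := by
    intro s
    have := (integrableOn_Ioi_comp_mul_left_iff (stableKer α 0 t s) 0 h2π).2
      (by simpa using integrableOn_stableKer h0 h1 0 ht s)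
    exact this.congr_fun (fun x hx => (hker s x hx).symm) measurableSet_Ioi
  have hψm : Measurable ψ := measurable_charFun.comp (measurable_const.mul measurable_id)
  -- Only positive frequencies are controlled directly; conjugate symmetry transfers integrability
  -- to the negative ones.
  have hψint : Integrable ψ := by
    rw [← integrableOn_univ, ← Iic_union_Ioi (a := (0 : ℝ))]
    have a : IntegrableOn ψ (Ioi 0) := by simpa using hI 0
    have b := ((Measure.measurePreserving_neg (volume : Measure ℝ)).integrableOn_comp_preimage
      (Homeomorph.neg ℝ).measurableEmbedding).2 a
    have hpre : (Neg.neg ⁻¹' Ioi (0 : ℝ)) = Iio 0 := by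
      ext
      simp
    rw [hpre] at b
    rw [integrableOn_union, integrableOn_Iic_iff_integrableOn_Iio]
    refine ⟨Integrable.mono' b.norm hψm.aestronglyMeasurable (Eventually.of_forall fun x => ?_), a⟩
    rw [Function.comp_apply, hneg, RCLike.norm_conj]
  have hF : ∀ s, 𝓕 ψ s = (stableDens α 0 t s : ℂ) := by
    intro s
    rw [Real.fourier_real_eq_integral_exp_smul]
    simp only [smul_eq_mul]
    set E : ℝ → ℂ := fun x => Complex.exp ((-2 * Real.pi * x * s : ℝ) * Complex.I) * ψ x with hE
    have hEint : Integrable E := by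
      refine Integrable.mono' hψint.norm ?_ (Eventually.of_forall fun x => ?_)
      · exact (Measurable.mul (by fun_prop) hψm).aestronglyMeasurable
      · rw [hE, norm_mul, Complex.norm_exp_ofReal_mul_I, one_mul]
    have hEneg : ∀ x, E (-x) = (starRingEnd ℂ) (E x) := by
      intro x
      simp only [hE, map_mul, hneg, ← Complex.exp_conj, Complex.conj_ofReal, Complex.conj_I]
      congr 2
      push_cast
      ring
    have hpos' : ∫ x in Ioi (0 : ℝ), E x = (2 * Real.pi)⁻¹ • stableInt α 0 t s := by
      rw [setIntegral_congr_fun measurableSet_Ioi (fun x hx => hker s x hx),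
        integral_comp_mul_left_Ioi (stableKer α 0 t s) 0 h2π, mul_zero]
      rfl
    -- Folding the negative half-line onto the positive one gives z + z̄ = 2 Re z, and 2 · (2π)⁻¹ is
    -- the prefactor 1/π.
    rw [← integral_add_compl (measurableSet_Ioi (a := (0 : ℝ))) hEint, compl_Ioi, ← neg_zero,
      ← integral_comp_neg_Ioi, neg_zero]
    simp only [hEneg]
    rw [integral_conj, hpos', Complex.add_conj, stableDens]
    simp
    field_simp
  exact eq_withDensity_of_integral_schwartz ν hcont fun f => by
    rw [integral_schwartz_eq_of_integrable_charFun ν hψint f]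
    simp only [← hF]
    rfl

end StableTimeFBM

end

/-! ### Decay of the density, differentiation under the integral and integration by parts. -/

noncomputable section

namespace StableTimeFBM

variable {α : ℝ}

lemma continuous_stableDens (h0 : 0 < α) (h1 : α < 1) {m : ℕ} (hα : α * (2 * m) = 1) (k : ℕ)
    {t : ℝ} (ht : 0 < t) : Continuous (stableDens α k t) :=
  continuous_iff_continuousAt.2 fun s =>
    (hasDerivAt_stableDens_space h0 h1 hα k ht s).continuousAt

/-- Vanishing at every positive time passes to time derivatives, and continuity in s includes the
origin. The case k = 0, `hvan`, is supplied later by the nonnegativity of the subordinator. -/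
lemma stableDens_eq_zero (h0 : 0 < α) (h1 : α < 1) {m : ℕ} (hα : α * (2 * m) = 1)
    (hvan : ∀ t s : ℝ, 0 < t → s < 0 → stableDens α 0 t s = 0) (k : ℕ) {t s : ℝ} (ht : 0 < t)
    (hs : s ≤ 0) : stableDens α k t s = 0 := by
  have hneg : ∀ k : ℕ, ∀ t s : ℝ, 0 < t → s < 0 → stableDens α k t s = 0 := by
    intro k
    induction k with
    | zero => exact hvan
    | succ k ih =>
      intro t s ht hs
      have hd := hasDerivAt_stableDens_time h0 h1 k ht s
      have hz : (fun τ => stableDens α k τ s) =ᶠ[𝓝 t] fun _ => 0 := by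
        filter_upwards [Ioi_mem_nhds ht] with τ hτ using ih τ s hτ hs
      exact hd.unique ((hasDerivAt_const t (0 : ℝ)).congr_of_eventuallyEq hz)
  have hcl : IsClosed {s | stableDens α k t s = 0} :=
    isClosed_eq (continuous_stableDens h0 h1 hα k ht) continuous_const
  have : closure (Iio (0 : ℝ)) ⊆ {s | stableDens α k t s = 0} :=
    closure_minimal (fun s hs => hneg k t s ht hs) hcl
  rw [closure_Iio] at this
  exact this hs

/-- All time derivatives of the stable density vanish to infinite order at the origin. -/
lemma abs_stableDens_le_pow (h0 : 0 < α) (h1 : α < 1) {m : ℕ} (hα : α * (2 * m) = 1)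
    (hvan : ∀ t s : ℝ, 0 < t → s < 0 → stableDens α 0 t s = 0) {t₀ : ℝ} (ht₀ : 0 < t₀) (N : ℕ) :
    ∀ k : ℕ, ∃ C, 0 ≤ C ∧ ∀ t s : ℝ, t₀ ≤ t → 0 ≤ s → |stableDens α k t s| ≤ C * s ^ N := by
  induction N with
  | zero =>
    intro k
    refine ⟨stableBound α k t₀, ?_, fun t s ht _ => ?_⟩
    · exact (abs_nonneg _).trans (abs_stableDens_le h0 h1 k ht₀ le_rfl 0)
    · simpa using abs_stableDens_le h0 h1 k ht₀ ht s
  | succ N ih =>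
    intro k
    -- The space derivative of index k has index k + 2m, so the induction on N must cover all k. The
    -- mean value inequality from the zero at s = 0 gains one power of s.
    obtain ⟨C, hC, h⟩ := ih (k + 2 * m)
    refine ⟨C, hC, fun t s ht hs => ?_⟩
    have htp : 0 < t := ht₀.trans_le ht
    have := (convex_Icc 0 s).norm_image_sub_le_of_norm_hasDerivWithin_le
      (f := stableDens α k t) (f' := stableDens α (k + 2 * m) t) (C := C * s ^ N)
      (fun σ _ => (hasDerivAt_stableDens_space h0 h1 hα k htp σ).hasDerivWithinAt)
      (fun σ hσ => (h t σ ht hσ.1).trans (by have := hσ.1; have := hσ.2; gcongr))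
      (left_mem_Icc.2 hs) (right_mem_Icc.2 hs)
    rw [stableDens_eq_zero h0 h1 hα hvan k htp le_rfl, sub_zero, sub_zero, Real.norm_eq_abs,
      Real.norm_of_nonneg hs] at this
    calc |stableDens α k t s| ≤ C * s ^ N * s := this
      _ = C * s ^ (N + 1) := by ring

/-- Integrable majorant for a negative power times a time derivative of the stable density,
locally uniform in time. -/
lemma exists_majorant (h0 : 0 < α) (h1 : α < 1) {m : ℕ} (hα : α * (2 * m) = 1)
    (hvan : ∀ t s : ℝ, 0 < t → s < 0 → stableDens α 0 t s = 0) {r : ℝ} (hr : r < 0) (k : ℕ)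
    {t₀ : ℝ} (ht₀ : 0 < t₀) (t₁ : ℝ) :
    ∃ g : ℝ → ℝ, IntegrableOn g (Ioi 0) ∧
      ∀ t ∈ Icc t₀ t₁, ∀ s ∈ Ioi (0 : ℝ), s ^ r * |stableDens α k t s| ≤ g s := by
  obtain ⟨N, hN⟩ := exists_nat_ge (-r)
  obtain ⟨C, hC, hsmall⟩ := abs_stableDens_le_pow h0 h1 hα hvan ht₀ N k
  set D := 1 + ∫ ξ in Ioi (0 : ℝ), stableAmpDeriv α k t₀ t₁ ξ with hD
  -- Near 0 vanishing to order N ≥ -r absorbs s^r; beyond 1 the O(1/s) decay leaves s^{r-1},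
  -- integrable exactly because r < 0.
  refine ⟨fun s => if s ≤ 1 then C else D * s ^ (r - 1), ?_, fun t ht s hs => ?_⟩
  · rw [← Ioc_union_Ioi_eq_Ioi (zero_le_one' ℝ), integrableOn_union]
    constructor
    · refine IntegrableOn.congr_fun (f := fun _ => C) (by simp) (fun s hs => ?_) measurableSet_Ioc
      simp [hs.2]
    · refine IntegrableOn.congr_fun (f := fun s => D * s ^ (r - 1))
        ((integrableOn_Ioi_rpow_of_lt (by linarith) zero_lt_one).const_mul D)
        (fun s hs => ?_) measurableSet_Ioi
      simp [not_le.2 (show 1 < s from hs)]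
  · have hs' : 0 < s := hs
    by_cases h : s ≤ 1
    · simp only [if_pos h]
      have hle : s ^ r * s ^ N ≤ 1 := by
        rw [← Real.rpow_natCast, ← Real.rpow_add hs']
        exact Real.rpow_le_one hs'.le h (by linarith)
      calc s ^ r * |stableDens α k t s| ≤ s ^ r * (C * s ^ N) := by
            gcongr
            exact hsmall t s ht.1 hs'.le
        _ = C * (s ^ r * s ^ N) := by ring
        _ ≤ C * 1 := by gcongr
        _ = C := mul_one C
    · simp only [if_neg h]
      have h2 := mul_norm_stableInt_le h0 h1 k ht₀ ht.1 ht.2 hs'.le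
      have h3 : s * |stableDens α k t s| ≤ D :=
        (mul_le_mul_of_nonneg_left (abs_stableDens_le_norm k t s) hs'.le).trans h2
      calc s ^ r * |stableDens α k t s| = s ^ (r - 1) * (s * |stableDens α k t s|) := by
            rw [Real.rpow_sub_one hs'.ne']
            field_simp
        _ ≤ s ^ (r - 1) * D := by gcongr
        _ = D * s ^ (r - 1) := mul_comm _ _

/-- The hypotheses on a weight function under which it can be integrated against the stable
density. -/
def IsPowerBounded (F : ℝ → ℝ) : Prop :=
  AEStronglyMeasurable F (volume.restrict (Ioi 0)) ∧
    ∃ C r : ℝ, 0 ≤ C ∧ r < 0 ∧ ∀ s ∈ Ioi (0 : ℝ), |F s| ≤ C * s ^ r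

lemma exists_majorant_mul (h0 : 0 < α) (h1 : α < 1) {m : ℕ} (hα : α * (2 * m) = 1)
    (hvan : ∀ t s : ℝ, 0 < t → s < 0 → stableDens α 0 t s = 0) {F : ℝ → ℝ} (hF : IsPowerBounded F)
    (k : ℕ) {t₀ : ℝ} (ht₀ : 0 < t₀) (t₁ : ℝ) :
    ∃ g : ℝ → ℝ, IntegrableOn g (Ioi 0) ∧
      ∀ t ∈ Icc t₀ t₁, ∀ s ∈ Ioi (0 : ℝ), ‖F s * stableDens α k t s‖ ≤ g s := by
  obtain ⟨-, C, r, hC, hr, hb⟩ := hF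
  obtain ⟨g, hg, hle⟩ := exists_majorant h0 h1 hα hvan hr k ht₀ t₁
  refine ⟨fun s => C * g s, hg.const_mul C, fun t ht s hs => ?_⟩
  rw [norm_mul, Real.norm_eq_abs, Real.norm_eq_abs]
  calc |F s| * |stableDens α k t s| ≤ C * s ^ r * |stableDens α k t s| := by
        gcongr
        exact hb s hs
    _ = C * (s ^ r * |stableDens α k t s|) := by ring
    _ ≤ C * g s := by
        gcongr
        exact hle t ht s hs

lemma IsPowerBounded.integrableOn_mul (h0 : 0 < α) (h1 : α < 1) {m : ℕ} (hα : α * (2 * m) = 1)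
    (hvan : ∀ t s : ℝ, 0 < t → s < 0 → stableDens α 0 t s = 0) {F : ℝ → ℝ} (hF : IsPowerBounded F)
    (k : ℕ) {t : ℝ} (ht : 0 < t) :
    IntegrableOn (fun s => F s * stableDens α k t s) (Ioi 0) := by
  obtain ⟨g, hg, hle⟩ := exists_majorant_mul h0 h1 hα hvan hF k ht t
  refine hg.mono' (hF.1.mul (continuous_stableDens h0 h1 hα k ht).aestronglyMeasurable) ?_
  filter_upwards [ae_restrict_mem measurableSet_Ioi] with s hs
  exact hle t ⟨le_rfl, le_rfl⟩ s hs

lemma IsPowerBounded.hasDerivAt_integral (h0 : 0 < α) (h1 : α < 1) {m : ℕ}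
    (hα : α * (2 * m) = 1) (hvan : ∀ t s : ℝ, 0 < t → s < 0 → stableDens α 0 t s = 0) {F : ℝ → ℝ}
    (hF : IsPowerBounded F) (k : ℕ) {t : ℝ} (ht : 0 < t) :
    HasDerivAt (fun τ => ∫ s in Ioi (0 : ℝ), F s * stableDens α k τ s)
      (∫ s in Ioi (0 : ℝ), F s * stableDens α (k + 1) t s) t := by
  obtain ⟨g, hg, hle⟩ := exists_majorant_mul h0 h1 hα hvan hF (k + 1) (half_pos ht) (2 * t)
  refine (hasDerivAt_integral_of_dominated_loc_of_deriv_le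
    (F := fun τ s => F s * stableDens α k τ s) (F' := fun τ s => F s * stableDens α (k + 1) τ s)
    (Icc_mem_nhds (half_lt_self ht) (by linarith : t < 2 * t)) ?_
    (hF.integrableOn_mul h0 h1 hα hvan k ht)
    (hF.1.mul (continuous_stableDens h0 h1 hα _ ht).aestronglyMeasurable) ?_ hg ?_).2
  · filter_upwards [Ioi_mem_nhds ht] with τ hτ
    exact hF.1.mul (continuous_stableDens h0 h1 hα _ hτ).aestronglyMeasurable
  · filter_upwards [ae_restrict_mem measurableSet_Ioi] with s hs τ hτ
    exact hle τ hτ s hs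
  · filter_upwards with s τ hτ
    exact (hasDerivAt_stableDens_time h0 h1 k (by linarith [hτ.1]) s).const_mul _

/-- A function on the half-line with a full chain of derivatives is smooth, and its iterated
derivatives are the members of the chain. -/
lemma contDiffOn_and_iteratedDeriv_of_chain {Q : ℕ → ℝ → ℝ}
    (hQ : ∀ k t, 0 < t → HasDerivAt (Q k) (Q (k + 1) t) t) (n : ℕ) :
    (∀ k, ContDiffOn ℝ n (Q k) (Ioi 0)) ∧
      ∀ k t, 0 < t → iteratedDeriv n (Q k) t = Q (k + n) t := by
  induction n with
  | zero =>
    refine ⟨fun k => ?_, fun k t _ => by simp⟩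
    simp only [Nat.cast_zero, contDiffOn_zero]
    exact fun t ht => (hQ k t ht).continuousAt.continuousWithinAt
  | succ n ih =>
    constructor
    · intro k
      push_cast
      rw [contDiffOn_succ_iff_deriv_of_isOpen isOpen_Ioi]
      refine ⟨fun t ht => (hQ k t ht).differentiableAt.differentiableWithinAt, by simp, ?_⟩
      exact (ih.1 (k + 1)).congr fun t ht => (hQ k t ht).deriv
    · intro k t ht
      rw [iteratedDeriv_succ]
      have : iteratedDeriv n (Q k) =ᶠ[𝓝 t] Q (k + n) := by
        filter_upwards [Ioi_mem_nhds ht] with τ hτ using ih.2 k τ hτ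
      rw [this.deriv_eq, (hQ (k + n) t ht).deriv, add_assoc]

/-- Integration by parts against the density: the time derivative of order `2m` is the space
derivative, which is moved to the weight. -/
lemma integral_mul_stableDens_eq_neg (h0 : 0 < α) (h1 : α < 1) {m : ℕ} (hα : α * (2 * m) = 1)
    (hvan : ∀ t s : ℝ, 0 < t → s < 0 → stableDens α 0 t s = 0) {F F' : ℝ → ℝ}
    (hF : IsPowerBounded F) (hF' : IsPowerBounded F')
    (hder : ∀ s ∈ Ioi (0 : ℝ), HasDerivAt F (F' s) s) {t : ℝ} (ht : 0 < t) :
    ∫ s in Ioi (0 : ℝ), F s * stableDens α (2 * m) t s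
      = -∫ s in Ioi (0 : ℝ), F' s * stableDens α 0 t s := by
  have hv : ∀ s ∈ Ioi (0 : ℝ), HasDerivAt (stableDens α 0 t) (stableDens α (2 * m) t s) s := by
    intro s _
    simpa using hasDerivAt_stableDens_space h0 h1 hα 0 ht s
  obtain ⟨-, C, r, hC, hr, hb⟩ := id hF
  -- The strict inequality N > -r is what makes the boundary term, of size s^{r+N}, tend to 0 at the
  -- origin.
  obtain ⟨N, hN⟩ := exists_nat_gt (-r)
  obtain ⟨K, hK, hsmall⟩ := abs_stableDens_le_pow h0 h1 hα hvan ht N 0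
  have hzero : Tendsto (F * stableDens α 0 t) (𝓝[>] 0) (𝓝 0) := by
    have hlim : Tendsto (fun s : ℝ => C * K * s ^ (r + N)) (𝓝[>] 0) (𝓝 0) := by
      have : Tendsto (fun s : ℝ => s ^ (r + N)) (𝓝[>] 0) (𝓝 0) := by
        have := (Real.continuousAt_rpow_const 0 (r + N) (Or.inr (by linarith))).tendsto
        rw [Real.zero_rpow (by linarith)] at this
        exact this.mono_left nhdsWithin_le_nhds
      simpa using this.const_mul (C * K)
    refine squeeze_zero_norm' ?_ hlim
    filter_upwards [self_mem_nhdsWithin] with s hs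
    have hs' : 0 < s := hs
    rw [Pi.mul_apply, norm_mul, Real.norm_eq_abs, Real.norm_eq_abs]
    calc |F s| * |stableDens α 0 t s| ≤ (C * s ^ r) * (K * s ^ N) := by
          gcongr
          · exact hb s hs
          · exact hsmall t s le_rfl hs'.le
      _ = C * K * s ^ (r + N) := by
          rw [Real.rpow_add hs', Real.rpow_natCast]
          ring
  have hinf : Tendsto (F * stableDens α 0 t) atTop (𝓝 0) := by
    have hlim : Tendsto (fun s : ℝ => C * stableBound α 0 t * s ^ r) atTop (𝓝 0) := by
      have := tendsto_rpow_neg_atTop (y := -r) (by linarith)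
      simpa using this.const_mul (C * stableBound α 0 t)
    refine squeeze_zero_norm' ?_ hlim
    filter_upwards [eventually_gt_atTop 0] with s hs
    rw [Pi.mul_apply, norm_mul, Real.norm_eq_abs, Real.norm_eq_abs]
    calc |F s| * |stableDens α 0 t s| ≤ (C * s ^ r) * stableBound α 0 t := by
          gcongr
          · exact hb s hs
          · exact abs_stableDens_le h0 h1 0 ht le_rfl s
      _ = C * stableBound α 0 t * s ^ r := by ring
  have := integral_Ioi_mul_deriv_eq_deriv_mul hder hv
    (hF.integrableOn_mul h0 h1 hα hvan (2 * m) ht) (hF'.integrableOn_mul h0 h1 hα hvan 0 ht)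
    hzero hinf
  rw [this]
  ring

end StableTimeFBM

end

/-! ### Spatial regularity and Laplacian of Gaussian mixtures. -/

noncomputable section

namespace StableTimeFBM

variable {E : Type*} [NormedAddCommGroup E] [InnerProductSpace ℝ E]

/-- A mixture of Gaussian bumps `e^{-|x|²/(2v)}` of variances `v = s^{2H}`. -/
def gaussMix (H : ℝ) (w : ℝ → ℝ) (x : E) : ℝ :=
  ∫ s in Ioi (0 : ℝ), w s * Real.exp (-‖x‖ ^ 2 / (2 * s ^ (2 * H)))

lemma exp_gauss_le_one {E : Type*} [NormedAddCommGroup E] (H : ℝ) {s : ℝ} (hs : 0 < s) (x : E) :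
    Real.exp (-‖x‖ ^ 2 / (2 * s ^ (2 * H))) ≤ 1 := by
  rw [Real.exp_le_one_iff, neg_div]
  have := Real.rpow_pos_of_pos hs (2 * H)
  exact neg_nonpos.2 (by positivity)

lemma integrableOn_mul_gauss {E : Type*} [NormedAddCommGroup E] (H : ℝ) {w : ℝ → ℝ} (hw : IntegrableOn w (Ioi 0)) (x : E) :
    IntegrableOn (fun s => w s * Real.exp (-‖x‖ ^ 2 / (2 * s ^ (2 * H)))) (Ioi 0) := by
  refine Integrable.mono' hw.norm (hw.1.mul
    (Measurable.aestronglyMeasurable (by fun_prop))) ?_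
  filter_upwards [ae_restrict_mem measurableSet_Ioi] with s hs
  rw [norm_mul, Real.norm_of_nonneg (Real.exp_nonneg _)]
  exact mul_le_of_le_one_right (norm_nonneg _) (exp_gauss_le_one H hs x)

lemma hasFDerivAt_gauss (v : ℝ) (x : E) :
    HasFDerivAt (fun y : E => Real.exp (-‖y‖ ^ 2 / (2 * v)))
      (-(v⁻¹ * Real.exp (-‖x‖ ^ 2 / (2 * v))) • innerSL ℝ x) x := by
  have h1 : HasFDerivAt (fun y : E => ‖y‖ ^ 2) (2 • innerSL ℝ x) x :=
    (hasStrictFDerivAt_norm_sq x).hasFDerivAt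
  have h2 := ((h1.neg).mul_const (2 * v)⁻¹).exp
  simp only [← div_eq_mul_inv] at h2
  refine h2.congr_fderiv ?_
  ext y
  simp
  ring

/-- Differentiating in x yields the factor -x and divides the weight by s^{2H}, so mixtures are
stable under differentiation and regularity reduces to integrability of the divided weights. -/
lemma hasFDerivAt_gaussMix (H : ℝ) {w : ℝ → ℝ} (hw : IntegrableOn w (Ioi 0))
    (hw' : IntegrableOn (fun s => w s / s ^ (2 * H)) (Ioi 0)) (x : E) :
    HasFDerivAt (gaussMix (E := E) H w)
      (-gaussMix H (fun s => w s / s ^ (2 * H)) x • innerSL ℝ x) x := by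
  set F' : E → ℝ → E →L[ℝ] ℝ := fun y s =>
    w s • (-((s ^ (2 * H))⁻¹ * Real.exp (-‖y‖ ^ 2 / (2 * s ^ (2 * H)))) • innerSL ℝ y) with hF'
  have hF'eq : ∀ y s, F' y s =
      (w s / s ^ (2 * H) * Real.exp (-‖y‖ ^ 2 / (2 * s ^ (2 * H)))) • -innerSL ℝ y := by
    intro y s
    simp only [hF', smul_neg, neg_smul, smul_smul]
    congr 2
    ring
  have key := hasFDerivAt_integral_of_dominated_of_fderiv_le (μ := volume.restrict (Ioi (0 : ℝ)))
    (F := fun (y : E) s => w s * Real.exp (-‖y‖ ^ 2 / (2 * s ^ (2 * H)))) (F' := F')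
    (bound := fun s => ‖w s / s ^ (2 * H)‖ * (‖x‖ + 1)) (Metric.ball_mem_nhds x zero_lt_one)
    (Eventually.of_forall fun y => (integrableOn_mul_gauss H hw y).1)
    (integrableOn_mul_gauss H hw x) ?_ ?_ (hw'.norm.mul_const _) ?_
  · refine key.congr_fderiv ?_
    rw [integral_congr_ae (Eventually.of_forall (hF'eq x)), integral_smul_const, gaussMix, smul_neg,
      neg_smul]
  · exact ((integrableOn_mul_gauss H hw' x).1.smul_const (-innerSL ℝ x)).congr
      (Eventually.of_forall fun s => (hF'eq x s).symm)
  · filter_upwards [ae_restrict_mem measurableSet_Ioi] with s hs y hy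
    rw [hF'eq, norm_smul, norm_neg, innerSL_apply_norm, norm_mul,
      Real.norm_of_nonneg (Real.exp_nonneg _)]
    have hy' : ‖y‖ ≤ ‖x‖ + 1 := by
      have h1 := norm_sub_norm_le y x
      have h2 : ‖y - x‖ < 1 := by simpa [dist_eq_norm] using hy
      linarith
    gcongr
    exact mul_le_of_le_one_right (norm_nonneg _) (exp_gauss_le_one H hs y)
  · filter_upwards with s y _
    exact (hasFDerivAt_gauss (s ^ (2 * H)) y).const_mul (w s)

/-- The third division serves only to make the twice-divided mixture differentiable, hence
continuous. -/
lemma contDiff_two_gaussMix (H : ℝ) {w : ℝ → ℝ} (hw : IntegrableOn w (Ioi 0))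
    (hw1 : IntegrableOn (fun s => w s / s ^ (2 * H)) (Ioi 0))
    (hw2 : IntegrableOn (fun s => w s / s ^ (2 * H) / s ^ (2 * H)) (Ioi 0))
    (hw3 : IntegrableOn (fun s => w s / s ^ (2 * H) / s ^ (2 * H) / s ^ (2 * H)) (Ioi 0)) :
    ContDiff ℝ 2 (gaussMix (E := E) H w) := by
  have key : ∀ (n : ℕ) {u : ℝ → ℝ}, IntegrableOn u (Ioi 0) →
      IntegrableOn (fun s => u s / s ^ (2 * H)) (Ioi 0) →
      ContDiff ℝ n (gaussMix (E := E) H fun s => u s / s ^ (2 * H)) →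
      ContDiff ℝ (n + 1) (gaussMix (E := E) H u) := by
    intro n u hu hu1 hc
    exact contDiff_succ_iff_hasFDerivAt.2
      ⟨_, hc.neg.smul (innerSL ℝ).contDiff, fun x => hasFDerivAt_gaussMix H hu hu1 x⟩
  have h0 : ContDiff ℝ (0 : ℕ) (gaussMix (E := E) H fun s => w s / s ^ (2 * H) / s ^ (2 * H)) := by
    simp only [Nat.cast_zero, contDiff_zero]
    exact continuous_iff_continuousAt.2 fun x => (hasFDerivAt_gaussMix H hw2 hw3 x).continuousAt
  have h1 := key 0 hw1 hw2 h0
  simp only [Nat.cast_zero, zero_add] at h1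
  have h2 := key 1 hw hw1 (by simpa using h1)
  norm_num at h2
  exact h2

lemma laplacian_gaussMix {d : ℕ} (H : ℝ) {w : ℝ → ℝ} (hw : IntegrableOn w (Ioi 0))
    (hw1 : IntegrableOn (fun s => w s / s ^ (2 * H)) (Ioi 0))
    (hw2 : IntegrableOn (fun s => w s / s ^ (2 * H) / s ^ (2 * H)) (Ioi 0))
    (x : EuclideanSpace ℝ (Fin d)) :
    Laplacian.laplacian (gaussMix (E := EuclideanSpace ℝ (Fin d)) H w) x =
      ‖x‖ ^ 2 * gaussMix H (fun s => w s / s ^ (2 * H) / s ^ (2 * H)) x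
        - d * gaussMix H (fun s => w s / s ^ (2 * H)) x := by
  rw [InnerProductSpace.laplacian_eq_iteratedFDeriv_orthonormalBasis _
    (EuclideanSpace.basisFun (Fin d) ℝ)]
  have h1 : fderiv ℝ (gaussMix (E := EuclideanSpace ℝ (Fin d)) H w) = fun y =>
      -gaussMix H (fun s => w s / s ^ (2 * H)) y • innerSL ℝ y :=
    funext fun y => (hasFDerivAt_gaussMix H hw hw1 y).fderiv
  have h2 := ((hasFDerivAt_gaussMix H hw1 hw2 x).neg).smul
    ((innerSL ℝ (E := EuclideanSpace ℝ (Fin d))).hasFDerivAt (x := x))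
  have h3 : ∀ i : Fin d, iteratedFDeriv ℝ 2 (gaussMix (E := EuclideanSpace ℝ (Fin d)) H w) x
      ![EuclideanSpace.basisFun (Fin d) ℝ i, EuclideanSpace.basisFun (Fin d) ℝ i]
      = gaussMix H (fun s => w s / s ^ (2 * H) / s ^ (2 * H)) x * (x i) ^ 2
        - gaussMix H (fun s => w s / s ^ (2 * H)) x := by
    intro i
    rw [iteratedFDeriv_two_apply, h1]
    have h4 : fderiv ℝ (fun y : EuclideanSpace ℝ (Fin d) =>
        -gaussMix H (fun s => w s / s ^ (2 * H)) y • innerSL ℝ y) x = _ := h2.fderiv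
    rw [h4]
    simp only [Matrix.cons_val_zero, Matrix.cons_val_one, add_apply,
      smul_apply, ContinuousLinearMap.smulRight_apply, Pi.neg_apply,
      neg_apply]
    have hi : ∀ a b : EuclideanSpace ℝ (Fin d), innerSL ℝ a b = inner ℝ a b := fun _ _ => rfl
    have hb : inner ℝ x (EuclideanSpace.basisFun (Fin d) ℝ i) = x i := by
      simp [EuclideanSpace.inner_single_right]
    have hu : inner ℝ (EuclideanSpace.basisFun (Fin d) ℝ i)
        (EuclideanSpace.basisFun (Fin d) ℝ i) = (1 : ℝ) := by
      simp
    simp only [hi, hb, hu, smul_eq_mul]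
    ring
  simp only [h3]
  rw [Finset.sum_sub_distrib, ← Finset.mul_sum, EuclideanSpace.real_norm_sq_eq]
  simp
  ring

end StableTimeFBM

end

/-! ### Heat equation for the Gaussian density and the equation for q. -/

noncomputable section

namespace StableTimeFBM

lemma fH_eq {d : ℕ} (H : ℝ) {s : ℝ} (hs : 0 < s) (x : EuclideanSpace ℝ (Fin d)) :
    fH H s x = (2 * Real.pi) ^ (-((d : ℝ) / 2)) * s ^ (-(H * d)) *
      Real.exp (-‖x‖ ^ 2 / (2 * s ^ (2 * H))) := by
  have e : (s ^ (2 * H)) ^ ((d : ℝ) / 2) = s ^ (H * d) := by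
    rw [← Real.rpow_mul hs.le]
    congr 1
    ring
  rw [fH, Real.mul_rpow (by positivity) (Real.rpow_nonneg hs.le _), e,
    Real.rpow_neg (by positivity), Real.rpow_neg hs.le]
  field_simp

lemma measurable_fH {d : ℕ} (H : ℝ) (x : EuclideanSpace ℝ (Fin d)) :
    Measurable fun s => fH H s x := by
  unfold fH
  fun_prop

/-- The derivative of the Gaussian density in the time variable. -/
def fHDeriv {d : ℕ} (H s : ℝ) (x : EuclideanSpace ℝ (Fin d)) : ℝ :=
  H * (s ^ (2 * H - 1) * fH H s x * (‖x‖ ^ 2 / s ^ (2 * H) / s ^ (2 * H) - d / s ^ (2 * H)))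

/-- This is ∂_v = Δ/2 at v = s^{2H} combined with dv/ds = 2H s^{2H-1}. In `fHDeriv` the last bracket
is Δf^H / f^H, in the form produced by `laplacian_gaussMix`. -/
lemma hasDerivAt_fH {d : ℕ} (H : ℝ) {s : ℝ} (hs : 0 < s) (x : EuclideanSpace ℝ (Fin d)) :
    HasDerivAt (fun σ => fH H σ x) (fHDeriv H s x) s := by
  have h1 : HasDerivAt (fun σ : ℝ => σ ^ (-(H * d))) (-(H * d) * s ^ (-(H * d) - 1)) s :=
    Real.hasDerivAt_rpow_const (Or.inl hs.ne')
  have h2 : HasDerivAt (fun σ : ℝ => σ ^ (2 * H)) (2 * H * s ^ (2 * H - 1)) s :=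
    Real.hasDerivAt_rpow_const (Or.inl hs.ne')
  have hv : 0 < s ^ (2 * H) := Real.rpow_pos_of_pos hs _
  have h3 := (((h2.const_mul 2).inv (by positivity)).const_mul (-‖x‖ ^ 2)).exp
  have h4 := (h1.const_mul ((2 * Real.pi) ^ (-((d : ℝ) / 2)))).mul h3
  have h5 : (fun σ => fH H σ x) =ᶠ[𝓝 s] fun σ => (2 * Real.pi) ^ (-((d : ℝ) / 2)) *
      σ ^ (-(H * d)) * Real.exp (-‖x‖ ^ 2 * (2 * σ ^ (2 * H))⁻¹) := by
    filter_upwards [Ioi_mem_nhds hs] with σ hσ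
    rw [fH_eq H hσ x, div_eq_mul_inv (-‖x‖ ^ 2)]
  refine (h4.congr_of_eventuallyEq h5).congr_deriv ?_
  rw [fHDeriv, fH_eq H hs x, Real.rpow_sub_one hs.ne', Real.rpow_sub_one hs.ne', div_eq_mul_inv]
  simp only [Pi.inv_apply]
  field_simp
  ring

lemma isPowerBounded_const_mul_rpow (C : ℝ) {r : ℝ} (hr : r < 0) :
    IsPowerBounded fun s => C * s ^ r := by
  refine ⟨Measurable.aestronglyMeasurable (by fun_prop), |C|, r, abs_nonneg C, hr, fun s hs => ?_⟩
  rw [abs_mul, abs_of_nonneg (Real.rpow_nonneg (le_of_lt hs) r)]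

lemma isPowerBounded_fH {d : ℕ} (hd : 1 ≤ d) {H : ℝ} (hH0 : 0 < H)
    (x : EuclideanSpace ℝ (Fin d)) : IsPowerBounded fun s => fH H s x := by
  have hd' : (1 : ℝ) ≤ d := by exact_mod_cast hd
  refine ⟨(measurable_fH H x).aestronglyMeasurable, (2 * Real.pi) ^ (-((d : ℝ) / 2)), -(H * d),
    by positivity, by nlinarith, fun s hs => ?_⟩
  have hs' : 0 < s := hs
  have := Real.rpow_nonneg hs'.le (-(H * d))
  simp only [fH_eq H hs]
  rw [abs_of_nonneg (by positivity)]
  exact mul_le_of_le_one_right (by positivity) (exp_gauss_le_one H hs x)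

lemma isPowerBounded_fHDeriv {d : ℕ} (hd : 1 ≤ d) {H : ℝ} (hH0 : 0 < H)
    (x : EuclideanSpace ℝ (Fin d)) : IsPowerBounded fun s => fHDeriv H s x := by
  have hd' : (1 : ℝ) ≤ d := by exact_mod_cast hd
  refine ⟨?_, H * (2 * Real.pi) ^ (-((d : ℝ) / 2)) * (2 + d), -(H * d) - 1,
    by positivity, by nlinarith, fun s hs => ?_⟩
  · have := measurable_fH H x
    unfold fHDeriv
    exact Measurable.aestronglyMeasurable (by fun_prop)
  · have hs' : 0 < s := hs
    have hv : 0 < s ^ (2 * H) := Real.rpow_pos_of_pos hs' _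
    have hp := Real.rpow_pos_of_pos hs' (-(H * d))
    set v := s ^ (2 * H) with hv'
    set e := Real.exp (-‖x‖ ^ 2 / (2 * v)) with he
    have he0 : 0 < e := Real.exp_pos _
    have he1 : e ≤ 1 := exp_gauss_le_one H hs' x
    -- With u = |x|²/v, the inequality u/2 + 1 ≤ e^{u/2} gives u e^{-u/2} ≤ 2, so the factor |x|²/v
    -- costs no further power of s.
    have hue : ‖x‖ ^ 2 / v * e ≤ 2 := by
      have h1 := Real.add_one_le_exp (‖x‖ ^ 2 / (2 * v))
      have h2 : Real.exp (‖x‖ ^ 2 / (2 * v)) * e = 1 := by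
        rw [he, ← Real.exp_add, ← add_div]
        simp
      have h3 : ‖x‖ ^ 2 / v = 2 * (‖x‖ ^ 2 / (2 * v)) := by field_simp
      rw [h3]
      nlinarith
    have hue0 : 0 ≤ ‖x‖ ^ 2 / v * e := by positivity
    have hbd : |‖x‖ ^ 2 / v * e - d * e| ≤ 2 + d := by
      rw [abs_le]
      constructor <;> nlinarith
    have : fHDeriv H s x = H * (2 * Real.pi) ^ (-((d : ℝ) / 2)) * (‖x‖ ^ 2 / v * e - d * e) *
        s ^ (-(H * d) - 1) := by
      rw [fHDeriv, fH_eq H hs', ← hv', ← he, Real.rpow_sub_one hs'.ne', Real.rpow_sub_one hs'.ne',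
        ← hv']
      field_simp
    have hc : 0 ≤ H * (2 * Real.pi) ^ (-((d : ℝ) / 2)) := by positivity
    have hq : 0 ≤ s ^ (-(H * d) - 1) := Real.rpow_nonneg hs'.le _
    simp only [this]
    rw [abs_mul, abs_mul, abs_of_nonneg hc, abs_of_nonneg hq]
    gcongr

/-- Since s^0 = 1, the convention at γ = 0 agrees with the integral, and H = 1/2 needs no separate
treatment. -/
lemma Vq_eq_integral {d : ℕ} (H : ℝ) (p : ℝ → ℝ → ℝ) (γ t : ℝ) (x : EuclideanSpace ℝ (Fin d)) :
    Vq H p γ t x = ∫ s in Ioi (0 : ℝ), s ^ γ * fH H s x * p t s := by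
  unfold Vq
  split_ifs with h
  · simp [h, q]
  · rfl

section Equation

variable {d : ℕ} {H α : ℝ} {m : ℕ} {p : ℝ → ℝ → ℝ}

/-- The mixing weight representing `V_{2H-1,t} q(t, ·)` as a Gaussian mixture. -/
def mixWeight (d : ℕ) (H α t s : ℝ) : ℝ :=
  (2 * Real.pi) ^ (-((d : ℝ) / 2)) * s ^ (2 * H - 1 - H * d) * stableDens α 0 t s

lemma rpow_mul_fH_mul_stableDens (H α t : ℝ) {s : ℝ} (hs : 0 < s)
    (x : EuclideanSpace ℝ (Fin d)) :
    s ^ (2 * H - 1) * fH H s x * stableDens α 0 t s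
      = mixWeight d H α t s * Real.exp (-‖x‖ ^ 2 / (2 * s ^ (2 * H))) := by
  rw [mixWeight, fH_eq H hs, sub_eq_add_neg (2 * H - 1), Real.rpow_add hs]
  ring

lemma q_eq_integral (hp : ∀ t : ℝ, 0 < t → p t =ᵐ[volume] stableDens α 0 t)
    {t : ℝ} (ht : 0 < t) (x : EuclideanSpace ℝ (Fin d)) :
    q H p t x = ∫ s in Ioi (0 : ℝ), fH H s x * stableDens α 0 t s := by
  refine integral_congr_ae ?_
  filter_upwards [ae_restrict_of_ae (hp t ht)] with s hs
  rw [hs]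

lemma Vq_eq_gaussMix (hp : ∀ t : ℝ, 0 < t → p t =ᵐ[volume] stableDens α 0 t)
    {t : ℝ} (ht : 0 < t) (x : EuclideanSpace ℝ (Fin d)) :
    Vq H p (2 * H - 1) t x = gaussMix H (mixWeight d H α t) x := by
  rw [Vq_eq_integral, gaussMix]
  refine integral_congr_ae ?_
  filter_upwards [ae_restrict_of_ae (hp t ht), ae_restrict_mem measurableSet_Ioi] with s hs hs'
  rw [hs, rpow_mul_fH_mul_stableDens H α t hs' x]

lemma integrableOn_mixWeight (hd : 1 ≤ d) (hH0 : 0 < H) (hH1 : H < 1) (h0 : 0 < α) (h1 : α < 1)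
    (hα : α * (2 * m) = 1) (hvan : ∀ t s : ℝ, 0 < t → s < 0 → stableDens α 0 t s = 0)
    {t : ℝ} (ht : 0 < t) :
    IntegrableOn (mixWeight d H α t) (Ioi 0) ∧
    IntegrableOn (fun s => mixWeight d H α t s / s ^ (2 * H)) (Ioi 0) ∧
    IntegrableOn (fun s => mixWeight d H α t s / s ^ (2 * H) / s ^ (2 * H)) (Ioi 0) ∧
    IntegrableOn (fun s => mixWeight d H α t s / s ^ (2 * H) / s ^ (2 * H) / s ^ (2 * H))
      (Ioi 0) := by
  have hd' : (1 : ℝ) ≤ d := by exact_mod_cast hd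
  -- From d ≥ 1 the exponent is at most H - 1, negative as H < 1. Each division by s^{2H} lowers it
  -- further.
  have hr : 2 * H - 1 - H * d < 0 := by nlinarith
  have key : ∀ r : ℝ, r < 0 → IntegrableOn (fun s =>
      (2 * Real.pi) ^ (-((d : ℝ) / 2)) * s ^ r * stableDens α 0 t s) (Ioi 0) := fun r hr =>
    (isPowerBounded_const_mul_rpow _ hr).integrableOn_mul h0 h1 hα hvan 0 ht
  refine ⟨key _ hr, ?_, ?_, ?_⟩
  · refine (key (2 * H - 1 - H * d - 2 * H) (by linarith)).congr_fun (fun s hs => ?_)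
      measurableSet_Ioi
    simp only [mixWeight, Real.rpow_sub hs]
    ring
  · refine (key (2 * H - 1 - H * d - 2 * H - 2 * H) (by linarith)).congr_fun (fun s hs => ?_)
      measurableSet_Ioi
    simp only [mixWeight, Real.rpow_sub hs]
    ring
  · refine (key (2 * H - 1 - H * d - 2 * H - 2 * H - 2 * H) (by linarith)).congr_fun
      (fun s hs => ?_) measurableSet_Ioi
    simp only [mixWeight, Real.rpow_sub hs]
    ring

lemma integrableOn_fH_mul (hd : 1 ≤ d) (hH0 : 0 < H) (h0 : 0 < α) (h1 : α < 1)
    (hα : α * (2 * m) = 1) (hvan : ∀ t s : ℝ, 0 < t → s < 0 → stableDens α 0 t s = 0)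
    (hp : ∀ t : ℝ, 0 < t → p t =ᵐ[volume] stableDens α 0 t)
    {t : ℝ} (ht : 0 < t) (x : EuclideanSpace ℝ (Fin d)) :
    IntegrableOn (fun s => fH H s x * p t s) (Ioi 0) := by
  refine ((isPowerBounded_fH hd hH0 x).integrableOn_mul h0 h1 hα hvan 0 ht).congr ?_
  filter_upwards [ae_restrict_of_ae (hp t ht)] with s hs
  rw [hs]

lemma integrableOn_rpow_mul_fH_mul (hd : 1 ≤ d) (hH0 : 0 < H) (hH1 : H < 1) (h0 : 0 < α)
    (h1 : α < 1) (hα : α * (2 * m) = 1) (hvan : ∀ t s : ℝ, 0 < t → s < 0 → stableDens α 0 t s = 0)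
    (hp : ∀ t : ℝ, 0 < t → p t =ᵐ[volume] stableDens α 0 t)
    {t : ℝ} (ht : 0 < t) (x : EuclideanSpace ℝ (Fin d)) :
    IntegrableOn (fun s => s ^ (2 * H - 1) * fH H s x * p t s) (Ioi 0) := by
  refine (integrableOn_mul_gauss H
    (integrableOn_mixWeight hd hH0 hH1 h0 h1 hα hvan ht).1 x).congr ?_
  filter_upwards [ae_restrict_of_ae (hp t ht), ae_restrict_mem measurableSet_Ioi] with s hs hs'
  rw [hs, rpow_mul_fH_mul_stableDens H α t hs' x]

lemma hasDerivAt_integral_fH_mul (hd : 1 ≤ d) (hH0 : 0 < H) (h0 : 0 < α) (h1 : α < 1)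
    (hα : α * (2 * m) = 1) (hvan : ∀ t s : ℝ, 0 < t → s < 0 → stableDens α 0 t s = 0)
    (x : EuclideanSpace ℝ (Fin d)) (k : ℕ) (t : ℝ) (ht : 0 < t) :
    HasDerivAt (fun τ => ∫ s in Ioi (0 : ℝ), fH H s x * stableDens α k τ s)
      (∫ s in Ioi (0 : ℝ), fH H s x * stableDens α (k + 1) t s) t :=
  (isPowerBounded_fH hd hH0 x).hasDerivAt_integral h0 h1 hα hvan k ht

lemma contDiffOn_q (hd : 1 ≤ d) (hH0 : 0 < H) (h0 : 0 < α) (h1 : α < 1) (hα : α * (2 * m) = 1)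
    (hvan : ∀ t s : ℝ, 0 < t → s < 0 → stableDens α 0 t s = 0)
    (hp : ∀ t : ℝ, 0 < t → p t =ᵐ[volume] stableDens α 0 t) (x : EuclideanSpace ℝ (Fin d)) (n : ℕ) :
    ContDiffOn ℝ n (fun t => q H p t x) (Ioi 0) :=
  ((contDiffOn_and_iteratedDeriv_of_chain
    (hasDerivAt_integral_fH_mul hd hH0 h0 h1 hα hvan x) n).1 0).congr
      fun _ ht => q_eq_integral hp ht x

lemma contDiff_Vq (hd : 1 ≤ d) (hH0 : 0 < H) (hH1 : H < 1) (h0 : 0 < α) (h1 : α < 1)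
    (hα : α * (2 * m) = 1) (hvan : ∀ t s : ℝ, 0 < t → s < 0 → stableDens α 0 t s = 0)
    (hp : ∀ t : ℝ, 0 < t → p t =ᵐ[volume] stableDens α 0 t) {t : ℝ} (ht : 0 < t) :
    ContDiff ℝ 2 (fun x : EuclideanSpace ℝ (Fin d) => Vq H p (2 * H - 1) t x) := by
  obtain ⟨i0, i1, i2, i3⟩ := integrableOn_mixWeight hd hH0 hH1 h0 h1 hα hvan ht
  rw [funext fun x => Vq_eq_gaussMix hp ht x]
  exact contDiff_two_gaussMix H i0 i1 i2 i3

lemma iteratedDeriv_q_eq (hd : 1 ≤ d) (hH0 : 0 < H) (hH1 : H < 1) (h0 : 0 < α) (h1 : α < 1)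
    (hα : α * (2 * m) = 1) (hvan : ∀ t s : ℝ, 0 < t → s < 0 → stableDens α 0 t s = 0)
    (hp : ∀ t : ℝ, 0 < t → p t =ᵐ[volume] stableDens α 0 t)
    {t : ℝ} (ht : 0 < t) (x : EuclideanSpace ℝ (Fin d)) :
    iteratedDeriv (2 * m) (fun τ => q H p τ x) t
      = -H * Laplacian.laplacian
          (fun y : EuclideanSpace ℝ (Fin d) => Vq H p (2 * H - 1) t y) x := by
  obtain ⟨i0, i1, i2, i3⟩ := integrableOn_mixWeight hd hH0 hH1 h0 h1 hα hvan ht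
  have e1 : iteratedDeriv (2 * m) (fun τ => q H p τ x) t
      = ∫ s in Ioi (0 : ℝ), fH H s x * stableDens α (2 * m) t s := by
    have heq : (fun τ => q H p τ x) =ᶠ[𝓝 t]
        fun τ => ∫ s in Ioi (0 : ℝ), fH H s x * stableDens α 0 τ s := by
      filter_upwards [Ioi_mem_nhds ht] with τ hτ using q_eq_integral hp hτ x
    rw [heq.iteratedDeriv_eq]
    simpa using (contDiffOn_and_iteratedDeriv_of_chain
      (hasDerivAt_integral_fH_mul hd hH0 h0 h1 hα hvan x) (2 * m)).2 0 t ht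
  rw [e1, integral_mul_stableDens_eq_neg h0 h1 hα hvan (isPowerBounded_fH hd hH0 x)
    (isPowerBounded_fHDeriv hd hH0 x) (fun s hs => hasDerivAt_fH H hs x) ht,
    funext fun x => Vq_eq_gaussMix hp ht x, laplacian_gaussMix H i0 i1 i2, neg_mul, neg_inj,
    gaussMix, gaussMix, ← integral_const_mul, ← integral_const_mul, ← integral_sub
      ((integrableOn_mul_gauss H i2 x).const_mul _) ((integrableOn_mul_gauss H i1 x).const_mul _),
    ← integral_const_mul]
  -- Both sides are now integrals over s, and the heat equation makes the integrands equal
  -- pointwise.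
  refine setIntegral_congr_fun measurableSet_Ioi fun s hs => ?_
  have := rpow_mul_fH_mul_stableDens H α t hs x
  simp only [fHDeriv]
  linear_combination H * (‖x‖ ^ 2 / s ^ (2 * H) / s ^ (2 * H) - d / s ^ (2 * H)) * this

end Equation

end StableTimeFBM

end

/-! ### Laws of the time-changed process and of the Gaussian mixture. -/

noncomputable section

namespace StableTimeFBM

variable {Ω : Type*} [MeasurableSpace Ω] {μ : Measure Ω} {d : ℕ} {H : ℝ}

lemma IsFBM.map_eq_gaussianReal {B : ℝ → Ω → ℝ} (hB : IsFBM H B μ) (hH0 : 0 < H) (s : ℝ) :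
    μ.map (B s) = gaussianReal 0 (|s| ^ (2 * H)).toNNReal := by
  have hvar : Var[B s; μ] = |s| ^ (2 * H) := by
    rw [variance_of_integral_eq_zero (hB.measurable s).aemeasurable (hB.centered s)]
    have := hB.covariance s s
    simp only [sub_self, abs_zero, Real.zero_rpow (by positivity : 2 * H ≠ 0), sub_zero] at this
    simp only [pow_two, this]
    ring
  rw [(hB.gaussian.hasGaussianLaw_eval s).map_eq_gaussianReal, hB.centered s, hvar]

lemma IsFBMVec.measurable {W : ℝ → Ω → EuclideanSpace ℝ (Fin d)} (hW : IsFBMVec H W μ) (s : ℝ) :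
    Measurable (W s) :=
  (MeasurableEquiv.toLp 2 (Fin d → ℝ)).measurable.comp
    (measurable_pi_iff.2 fun i => (hW.coord i).measurable s)

lemma IsFBMVec.continuous_paths {W : ℝ → Ω → EuclideanSpace ℝ (Fin d)} (hW : IsFBMVec H W μ) :
    ∀ᵐ ω ∂μ, Continuous fun s => W s ω := by
  filter_upwards [ae_all_iff.2 fun i => (hW.coord i).continuous] with ω hω
  exact (PiLp.continuous_toLp 2 fun _ : Fin d => ℝ).comp (continuous_pi hω)

lemma IsFBMVec.charFun_map [IsProbabilityMeasure μ] {W : ℝ → Ω → EuclideanSpace ℝ (Fin d)}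
    (hW : IsFBMVec H W μ) (hH0 : 0 < H) (s : ℝ) (ξ : EuclideanSpace ℝ (Fin d)) :
    charFun (μ.map (W s)) ξ = Complex.exp (-(|s| ^ (2 * H) * ‖ξ‖ ^ 2 / 2 : ℝ)) := by
  have hind : iIndepFun (fun (i : Fin d) (ω : Ω) => W s ω i) μ :=
    hW.indep.comp (fun _ w => w s) fun _ => measurable_pi_apply s
  have h := (iIndepFun_iff_charFun_pi
    (fun i => ((hW.coord i).measurable s).aemeasurable)).1 hind ξ
  refine h.trans ?_
  have hv : 0 ≤ |s| ^ (2 * H) := Real.rpow_nonneg (abs_nonneg s) _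
  simp only [(hW.coord _).map_eq_gaussianReal hH0 s, charFun_gaussianReal, ← Complex.exp_sum]
  congr 1
  rw [EuclideanSpace.real_norm_sq_eq, Finset.mul_sum, Finset.sum_div,
    Complex.ofReal_sum, ← Finset.sum_neg_distrib]
  refine Finset.sum_congr rfl fun i _ => ?_
  have : (((|s| ^ (2 * H)).toNNReal : ℝ) : ℂ) = ((|s| ^ (2 * H) : ℝ) : ℂ) := by
    rw [Real.coe_toNNReal _ hv]
  rw [this]
  push_cast
  ring

/-- Discretization of a nonnegative real to the grid `ℕ / (n + 1)`. -/
def gridFloor (n : ℕ) (y : ℝ) : ℝ := ⌊y * (n + 1)⌋₊ / (n + 1)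

lemma measurable_gridFloor (n : ℕ) : Measurable (gridFloor n) := by
  unfold gridFloor
  fun_prop

lemma tendsto_gridFloor {y : ℝ} (hy : 0 ≤ y) : Tendsto (fun n => gridFloor n y) atTop (𝓝 y) := by
  have h : Tendsto (fun n : ℕ => (n : ℝ) + 1) atTop atTop :=
    tendsto_atTop_add_const_right _ _ tendsto_natCast_atTop_atTop
  exact (tendsto_nat_floor_mul_div_atTop hy).comp h

/-- Evaluation (w, y) ↦ w(y) need not be measurable for the product σ-algebra on paths. Rounding the
time to a countable grid restores measurability, and path continuity later removes the rounding. -/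
lemma measurable_eval_gridFloor {E : Type*} [MeasurableSpace E] (n : ℕ) :
    Measurable fun z : (ℝ → E) × ℝ => z.1 (gridFloor n z.2) := by
  have h1 : Measurable fun z : (ℝ → E) × ℕ => z.1 ((z.2 : ℝ) / (n + 1)) :=
    measurable_from_prod_countable_left fun k => measurable_pi_apply ((k : ℝ) / (n + 1))
  have h2 : Measurable fun z : (ℝ → E) × ℝ => (z.1, ⌊z.2 * (n + 1)⌋₊) := by fun_prop
  exact h1.comp h2

/-- A process with measurable marginals and almost surely continuous paths, evaluated at a random
nonnegative time, is a random variable. -/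
lemma aemeasurable_comp_time {E : Type*} [MeasurableSpace E] [TopologicalSpace E]
    [TopologicalSpace.PseudoMetrizableSpace E] [BorelSpace E] {W : ℝ → Ω → E}
    (hWm : ∀ s, Measurable (W s)) (hWc : ∀ᵐ ω ∂μ, Continuous fun s => W s ω) {T : Ω → ℝ}
    (hT : Measurable T) (hT0 : ∀ᵐ ω ∂μ, 0 ≤ T ω) : AEMeasurable (fun ω => W (T ω) ω) μ := by
  refine aemeasurable_of_tendsto_metrizable_ae atTop
    (f := fun (n : ℕ) ω => W (gridFloor n (T ω)) ω) (fun n => ?_) ?_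
  · exact ((measurable_eval_gridFloor n).comp
      ((measurable_pi_iff.2 hWm).prodMk hT)).aemeasurable
  · filter_upwards [hWc, hT0] with ω hω h0
    exact (hω.tendsto _).comp (tendsto_gridFloor h0)

/-- Characteristic function of a process evaluated at an independent random time. -/
lemma charFun_map_comp_time [IsProbabilityMeasure μ] {W : ℝ → Ω → EuclideanSpace ℝ (Fin d)}
    (hWm : ∀ s, Measurable (W s)) (hWc : ∀ᵐ ω ∂μ, Continuous fun s => W s ω) {T : Ω → ℝ}
    (hT : Measurable T) (hT0 : ∀ᵐ ω ∂μ, 0 ≤ T ω) (hind : IndepFun (fun ω t => W t ω) T μ)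
    (ξ : EuclideanSpace ℝ (Fin d)) {φ : ℝ → ℂ} (hφ : ∀ s, charFun (μ.map (W s)) ξ = φ s)
    (hφc : Continuous φ) :
    charFun (μ.map fun ω => W (T ω) ω) ξ = ∫ y, φ y ∂(μ.map T) := by
  have hWp : Measurable fun ω t => W t ω := measurable_pi_iff.2 hWm
  have hT0' : ∀ᵐ y ∂(μ.map T), 0 ≤ y := by
    rw [ae_map_iff hT.aemeasurable measurableSet_Ici]
    exact hT0
  have := Measure.isProbabilityMeasure_map (μ := μ) hT.aemeasurable
  have := Measure.isProbabilityMeasure_map (μ := μ) hWp.aemeasurable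
  have hec : Continuous fun x : EuclideanSpace ℝ (Fin d) => Complex.exp (inner ℝ x ξ * Complex.I) :=
    by fun_prop
  have hnorm : ∀ x : EuclideanSpace ℝ (Fin d), ‖Complex.exp (inner ℝ x ξ * Complex.I)‖ ≤ 1 :=
    fun x => (Complex.norm_exp_ofReal_mul_I _).le
  -- On the grid, independence and Fubini allow conditioning on the time; dominated convergence then
  -- passes to the limit on both sides.
  have hgrid : ∀ n : ℕ, ∫ ω, Complex.exp (inner ℝ (W (gridFloor n (T ω)) ω) ξ * Complex.I) ∂μ
      = ∫ y, φ (gridFloor n y) ∂(μ.map T) := by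
    intro n
    set g : (ℝ → EuclideanSpace ℝ (Fin d)) × ℝ → ℂ := fun z =>
      Complex.exp (inner ℝ (z.1 (gridFloor n z.2)) ξ * Complex.I) with hg
    have hgm : Measurable g := hec.measurable.comp (measurable_eval_gridFloor n)
    have e1 : ∫ ω, Complex.exp (inner ℝ (W (gridFloor n (T ω)) ω) ξ * Complex.I) ∂μ
        = ∫ z, g z ∂((μ.map fun ω t => W t ω).prod (μ.map T)) := by
      rw [← (indepFun_iff_map_prod_eq_prod_map_map hWp.aemeasurable hT.aemeasurable).1 hind,
        integral_map (hWp.prodMk hT).aemeasurable hgm.aestronglyMeasurable]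
    have hgint : Integrable g ((μ.map fun ω t => W t ω).prod (μ.map T)) :=
      (integrable_const (1 : ℝ)).mono' hgm.aestronglyMeasurable
        (Eventually.of_forall fun z => hnorm _)
    rw [e1, integral_prod_symm _ hgint]
    refine integral_congr_ae (Eventually.of_forall fun y => ?_)
    have hev : AEStronglyMeasurable (fun w : ℝ → EuclideanSpace ℝ (Fin d) =>
        Complex.exp (inner ℝ (w (gridFloor n y)) ξ * Complex.I)) (μ.map fun ω t => W t ω) :=
      (hec.measurable.comp (measurable_pi_apply (gridFloor n y))).aestronglyMeasurable
    simp only [hg]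
    rw [integral_map hWp.aemeasurable hev, ← hφ, charFun_apply,
      integral_map (hWm _).aemeasurable hec.aestronglyMeasurable]
  have hφ1 : ∀ s, ‖φ s‖ ≤ 1 := fun s => by
    have := Measure.isProbabilityMeasure_map (μ := μ) (hWm s).aemeasurable
    rw [← hφ]
    exact norm_charFun_le_one ξ
  have l1 : Tendsto (fun n : ℕ =>
      ∫ ω, Complex.exp (inner ℝ (W (gridFloor n (T ω)) ω) ξ * Complex.I) ∂μ) atTop
      (𝓝 (∫ ω, Complex.exp (inner ℝ (W (T ω) ω) ξ * Complex.I) ∂μ)) := by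
    refine tendsto_integral_of_dominated_convergence (fun _ => 1) (fun n => ?_)
      (integrable_const _) (fun n => Eventually.of_forall fun ω => hnorm _) ?_
    · exact (hec.measurable.comp ((measurable_eval_gridFloor n).comp
        (hWp.prodMk hT))).aestronglyMeasurable
    · filter_upwards [hWc, hT0] with ω hω h0
      exact (hec.tendsto _).comp ((hω.tendsto _).comp (tendsto_gridFloor h0))
  have l2 : Tendsto (fun n : ℕ => ∫ y, φ (gridFloor n y) ∂(μ.map T)) atTop
      (𝓝 (∫ y, φ y ∂(μ.map T))) := by
    refine tendsto_integral_of_dominated_convergence (fun _ => 1) (fun n => ?_)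
      (integrable_const _) (fun n => Eventually.of_forall fun y => hφ1 _) ?_
    · exact (hφc.measurable.comp (measurable_gridFloor n)).aestronglyMeasurable
    · filter_upwards [hT0'] with y hy
      exact (hφc.tendsto _).comp (tendsto_gridFloor hy)
  simp only [hgrid] at l1
  rw [charFun_apply, integral_map (aemeasurable_comp_time hWm hWc hT hT0) hec.aestronglyMeasurable]
  exact tendsto_nhds_unique l1 l2

lemma measurable_uncurry_fH (H : ℝ) :
    Measurable fun z : ℝ × EuclideanSpace ℝ (Fin d) => fH H z.1 z.2 := by
  unfold fH
  fun_prop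

lemma fH_nonneg (H : ℝ) {s : ℝ} (hs : 0 < s) (x : EuclideanSpace ℝ (Fin d)) : 0 ≤ fH H s x := by
  have := Real.rpow_pos_of_pos hs (2 * H)
  unfold fH
  positivity

/-- Fourier transform of the Gaussian density. -/
lemma fourier_fH (H : ℝ) {s : ℝ} (hs : 0 < s) (ξ : EuclideanSpace ℝ (Fin d)) :
    Integrable (fun x => Complex.exp (inner ℝ x ξ * Complex.I) * (fH H s x : ℂ)) ∧
    ∫ x, Complex.exp (inner ℝ x ξ * Complex.I) * (fH H s x : ℂ)
      = Complex.exp (-(s ^ (2 * H) * ‖ξ‖ ^ 2 / 2 : ℝ)) := by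
  set v := s ^ (2 * H) with hv
  have hv0 : 0 < v := Real.rpow_pos_of_pos hs _
  set b : ℝ := 1 / (2 * v) with hb
  have hb0 : 0 < b := by positivity
  set A : ℝ := (2 * Real.pi * v) ^ ((d : ℝ) / 2) with hA
  have hA0 : 0 < A := by positivity
  have heq : ∀ x : EuclideanSpace ℝ (Fin d),
      Complex.exp (inner ℝ x ξ * Complex.I) * (fH H s x : ℂ)
        = (A : ℂ)⁻¹ * Complex.exp (-(b : ℂ) * ‖x‖ ^ 2 + Complex.I * inner ℝ ξ x) := by
    intro x
    rw [fH, ← hv, ← hA, Complex.exp_add, real_inner_comm ξ x]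
    push_cast
    rw [hb, div_eq_mul_inv, mul_comm Complex.I]
    have : (-(‖x‖ : ℂ) ^ 2 / (2 * v)) = -((1 / (2 * v) : ℝ) : ℂ) * ‖x‖ ^ 2 := by
      push_cast
      ring
    rw [this]
    ring
  simp only [heq]
  refine ⟨(GaussianFourier.integrable_cexp_neg_mul_sq_norm_add_of_euclideanSpace
    (by simpa using hb0) _ _).const_mul _, ?_⟩
  rw [integral_const_mul, GaussianFourier.integral_cexp_neg_mul_sq_norm_add_of_euclideanSpace
    (by simpa using hb0), Fintype.card_fin]
  have e1 : ((Real.pi : ℂ) / b) ^ ((d : ℂ) / 2) = A := by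
    rw [hA, Complex.ofReal_cpow (by positivity), hb]
    push_cast
    congr 1
    field_simp
  rw [e1, inv_mul_cancel_left₀ (by exact_mod_cast hA0.ne'), Complex.I_sq, hb]
  congr 1
  push_cast
  field_simp
  norm_num

lemma integrable_fH (H : ℝ) {s : ℝ} (hs : 0 < s) :
    Integrable (fun x : EuclideanSpace ℝ (Fin d) => fH H s x) := by
  have := (fourier_fH (d := d) H hs 0).1.re
  simpa using this

lemma integral_fH (H : ℝ) {s : ℝ} (hs : 0 < s) :
    ∫ x : EuclideanSpace ℝ (Fin d), fH H s x = 1 := by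
  have := (fourier_fH (d := d) H hs 0).2
  simp only [inner_zero_right, Complex.ofReal_zero, zero_mul, Complex.exp_zero, one_mul] at this
  rw [integral_complex_ofReal] at this
  simpa using this

/-- The Gaussian mixture with an integrable nonnegative mixing density: finiteness and
characteristic function. -/
lemma charFun_withDensity_mixture (H : ℝ) {D : ℝ → ℝ} (hDm : Measurable D) (hD0 : ∀ s, 0 ≤ D s)
    (hD : IntegrableOn D (Ioi 0)) (ξ : EuclideanSpace ℝ (Fin d)) :
    IsFiniteMeasure ((volume : Measure (EuclideanSpace ℝ (Fin d))).withDensity fun x =>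
      ENNReal.ofReal (∫ s in Ioi (0 : ℝ), fH H s x * D s)) ∧
    charFun ((volume : Measure (EuclideanSpace ℝ (Fin d))).withDensity fun x =>
      ENNReal.ofReal (∫ s in Ioi (0 : ℝ), fH H s x * D s)) ξ
      = ∫ s in Ioi (0 : ℝ), Complex.exp (-(s ^ (2 * H) * ‖ξ‖ ^ 2 / 2 : ℝ)) * (D s : ℂ) := by
  have hm : Measurable fun z : ℝ × EuclideanSpace ℝ (Fin d) => fH H z.1 z.2 * D z.1 :=
    (measurable_uncurry_fH H).mul (hDm.comp measurable_fst)
  -- Each Gaussian density has integral 1 in x, so joint integrability reduces to that of the mixing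
  -- density.
  have hint : Integrable (fun z : ℝ × EuclideanSpace ℝ (Fin d) => fH H z.1 z.2 * D z.1)
      ((volume.restrict (Ioi 0)).prod volume) := by
    refine (integrable_prod_iff hm.aestronglyMeasurable).2 ⟨?_, ?_⟩
    · filter_upwards [ae_restrict_mem measurableSet_Ioi] with s hs
      exact (integrable_fH H hs).mul_const _
    · refine hD.integrable.congr ?_
      filter_upwards [ae_restrict_mem measurableSet_Ioi] with s hs
      have : ∀ x : EuclideanSpace ℝ (Fin d), ‖fH H s x * D s‖ = fH H s x * D s := fun x =>
        Real.norm_of_nonneg (mul_nonneg (fH_nonneg H hs x) (hD0 s))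
      simp only [this]
      rw [integral_mul_const, integral_fH H hs, one_mul]
  have hqint := hint.integral_prod_right
  have hq0 : ∀ x : EuclideanSpace ℝ (Fin d), 0 ≤ ∫ s in Ioi (0 : ℝ), fH H s x * D s := fun x =>
    setIntegral_nonneg measurableSet_Ioi fun s hs => mul_nonneg (fH_nonneg H hs x) (hD0 s)
  refine ⟨isFiniteMeasure_withDensity_ofReal hqint.2, ?_⟩
  rw [charFun_apply, integral_withDensity_eq_integral_toReal_smul₀
    hqint.1.aemeasurable.ennreal_ofReal (Eventually.of_forall fun _ => ENNReal.ofReal_lt_top)]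
  have hec : Continuous fun x : EuclideanSpace ℝ (Fin d) => Complex.exp (inner ℝ x ξ * Complex.I) :=
    by fun_prop
  have e1 : ∀ x : EuclideanSpace ℝ (Fin d),
      (ENNReal.ofReal (∫ s in Ioi (0 : ℝ), fH H s x * D s)).toReal •
        Complex.exp (inner ℝ x ξ * Complex.I)
      = ∫ s in Ioi (0 : ℝ), Complex.exp (inner ℝ x ξ * Complex.I) * ((fH H s x * D s : ℝ) : ℂ) := by
    intro x
    rw [ENNReal.toReal_ofReal (hq0 x), integral_const_mul, integral_complex_ofReal,
      Complex.real_smul, mul_comm]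
  simp only [e1]
  rw [integral_integral_swap]
  · refine setIntegral_congr_fun measurableSet_Ioi fun s hs => ?_
    rw [← (fourier_fH H hs ξ).2, ← integral_mul_const]
    congr 1
    ext x
    push_cast
    ring
  · refine hint.swap.norm.mono' ?_ (Eventually.of_forall fun z => ?_)
    · exact ((hec.measurable.comp measurable_fst).mul
        (Complex.measurable_ofReal.comp (hm.comp measurable_swap))).aestronglyMeasurable
    · simp only [Function.uncurry, Function.comp_apply, Prod.swap]
      rw [norm_mul, Complex.norm_exp_ofReal_mul_I, one_mul, Complex.norm_real]

lemma IsStableSubordinator.nonneg {α : ℝ} {Y : ℝ≥0 → Ω → ℝ}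
    (hY : IsStableSubordinator α Y μ) (t : ℝ≥0) : ∀ᵐ ω ∂μ, 0 ≤ Y t ω := by
  filter_upwards [hY.monotone, hY.zero] with ω hω hω0
  rw [← hω0]
  exact hω zero_le

/-- The law of a stable subordinator at a positive time has the density `stableDens α 0`. -/
lemma IsStableSubordinator.map_eq_withDensity [IsProbabilityMeasure μ] {α : ℝ} {Y : ℝ≥0 → Ω → ℝ}
    (hY : IsStableSubordinator α Y μ) (h0 : 0 < α) (h1 : α < 1) {m : ℕ} (hα : α * (2 * m) = 1)
    {t : ℝ≥0} (ht : 0 < t) :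
    (∀ s, 0 ≤ stableDens α 0 t s) ∧
      μ.map (Y t) = volume.withDensity fun s => ENNReal.ofReal (stableDens α 0 t s) := by
  have hm := (hY.measurable t).aemeasurable (μ := μ)
  have := Measure.isProbabilityMeasure_map hm
  refine eq_withDensity_of_laplace h0 h1 (NNReal.coe_pos.2 ht) _ ?_ (fun l hl => ?_)
    (continuous_stableDens h0 h1 hα 0 (NNReal.coe_pos.2 ht))
  · rw [ae_map_iff hm measurableSet_Ici]
    exact hY.nonneg t
  · rw [integral_map hm (by fun_prop)]
    exact hY.laplace t l hl

end StableTimeFBM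

end

/-! ### Consequences for the subordinator and the subordinated process. -/

noncomputable section

namespace StableTimeFBM

variable {Ω : Type*} [MeasurableSpace Ω] {μ : Measure Ω} [IsProbabilityMeasure μ] {α : ℝ}
  {Y : ℝ≥0 → Ω → ℝ}

/-- The law of Y(t) gives no mass to the negative axis, so its density vanishes there almost
everywhere, and by continuity everywhere. No contour deformation of the Fourier integral is needed.
-/
lemma IsStableSubordinator.stableDens_eq_zero (hY : IsStableSubordinator α Y μ) (h0 : 0 < α)
    (h1 : α < 1) {m : ℕ} (hα : α * (2 * m) = 1) {t s : ℝ} (ht : 0 < t) (hs : s < 0) :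
    stableDens α 0 t s = 0 := by
  lift t to ℝ≥0 using ht.le
  have ht' : 0 < t := NNReal.coe_pos.1 ht
  obtain ⟨hnn, hlaw⟩ := hY.map_eq_withDensity h0 h1 hα ht'
  have hcont := continuous_stableDens h0 h1 hα 0 ht
  have hz : μ.map (Y t) (Iio 0) = 0 := by
    rw [Measure.map_apply (hY.measurable t) measurableSet_Iio]
    refine measure_mono_null (fun ω hω => ?_) (ae_iff.1 (hY.nonneg t))
    exact not_le.2 hω
  rw [hlaw, withDensity_apply _ measurableSet_Iio,
    lintegral_eq_zero_iff hcont.measurable.ennreal_ofReal] at hz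
  have hae : stableDens α 0 t =ᵐ[volume.restrict (Iio 0)] fun _ => 0 := by
    filter_upwards [hz] with u hu
    exact le_antisymm (ENNReal.ofReal_eq_zero.1 hu) (hnn u)
  exact Measure.eqOn_open_of_ae_eq hae isOpen_Iio hcont.continuousOn continuousOn_const hs

lemma IsStableSubordinator.hasPDF (hY : IsStableSubordinator α Y μ) (h0 : 0 < α)
    (h1 : α < 1) {m : ℕ} (hα : α * (2 * m) = 1) {t : ℝ≥0} (ht : 0 < t) :
    HasPDF (Y t) μ volume :=
  hasPDF_of_map_eq_withDensity (hY.measurable t).aemeasurable _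
    (continuous_stableDens h0 h1 hα 0
      (NNReal.coe_pos.2 ht)).measurable.ennreal_ofReal.aemeasurable
    (hY.map_eq_withDensity h0 h1 hα ht).2

/-- A density is determined only almost everywhere; the integrals defining q and Vq do not see the
difference, so they may be computed with the smooth version. -/
lemma IsStableSubordinator.pY_ae_eq (hY : IsStableSubordinator α Y μ) (h0 : 0 < α)
    (h1 : α < 1) {m : ℕ} (hα : α * (2 * m) = 1) {t : ℝ} (ht : 0 < t) :
    pY Y μ t =ᵐ[volume] stableDens α 0 t := by
  lift t to ℝ≥0 using ht.le
  have ht' : 0 < t := NNReal.coe_pos.1 ht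
  obtain ⟨hnn, hlaw⟩ := hY.map_eq_withDensity h0 h1 hα ht'
  have := hY.hasPDF h0 h1 hα ht'
  have hpdf := (pdf.eq_of_map_eq_withDensity (X := Y t) _
    (continuous_stableDens h0 h1 hα 0 ht).measurable.ennreal_ofReal.aemeasurable).1 hlaw
  filter_upwards [hpdf] with s hs
  rw [pY, Real.toNNReal_coe, hs, ENNReal.toReal_ofReal (hnn s)]

lemma IsStableSubordinator.integrable_stableDens (hY : IsStableSubordinator α Y μ) (h0 : 0 < α)
    (h1 : α < 1) {m : ℕ} (hα : α * (2 * m) = 1) {t : ℝ≥0} (ht : 0 < t) :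
    Integrable (stableDens α 0 t) := by
  obtain ⟨hnn, hlaw⟩ := hY.map_eq_withDensity h0 h1 hα ht
  have hcont := continuous_stableDens h0 h1 hα 0 (NNReal.coe_pos.2 ht)
  have := Measure.isProbabilityMeasure_map (μ := μ) (hY.measurable t).aemeasurable
  refine ⟨hcont.aestronglyMeasurable, ?_⟩
  rw [hasFiniteIntegral_iff_ofReal (Eventually.of_forall hnn)]
  have h : (μ.map (Y t)) univ < ∞ := measure_lt_top _ _
  rwa [hlaw, withDensity_apply _ MeasurableSet.univ, Measure.restrict_univ] at h

/-- The law of a fractional Brownian motion at an independent stable subordinator. -/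
lemma map_comp_subordinator {d : ℕ} {H : ℝ} (hH0 : 0 < H)
    {W : ℝ → Ω → EuclideanSpace ℝ (Fin d)} (hW : IsFBMVec H W μ)
    (hY : IsStableSubordinator α Y μ) (h0 : 0 < α) (h1 : α < 1) {m : ℕ} (hα : α * (2 * m) = 1)
    (hWY : IndepFun (fun ω t => W t ω) (fun ω t => Y t ω) μ) {t : ℝ≥0} (ht : 0 < t) :
    μ.map (fun ω => W (Y t ω) ω) = volume.withDensity fun x =>
      ENNReal.ofReal (∫ s in Ioi (0 : ℝ), fH H s x * stableDens α 0 t s) := by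
  obtain ⟨hnn, hlaw⟩ := hY.map_eq_withDensity h0 h1 hα ht
  have hcont := continuous_stableDens h0 h1 hα 0 (NNReal.coe_pos.2 ht)
  have hmix := fun ξ => charFun_withDensity_mixture (d := d) H hcont.measurable hnn
    (hY.integrable_stableDens h0 h1 hα ht).integrableOn ξ
  have := (hmix 0).1
  have hind : IndepFun (fun ω t => W t ω) (Y t) μ :=
    hWY.comp measurable_id (measurable_pi_apply t)
  refine Measure.ext_of_charFun (funext fun ξ => ?_)
  -- The absolute value extends the variance continuously to all real times, as
  -- `charFun_map_comp_time` requires; it disappears once the integral is restricted to s > 0.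
  have hφc : Continuous fun s : ℝ => Complex.exp (-(|s| ^ (2 * H) * ‖ξ‖ ^ 2 / 2 : ℝ)) := by
    have : Continuous fun s : ℝ => |s| ^ (2 * H) :=
      continuous_abs.rpow_const fun _ => Or.inr (by positivity)
    fun_prop
  rw [charFun_map_comp_time hW.measurable hW.continuous_paths (hY.measurable t) (hY.nonneg t) hind
    ξ (hW.charFun_map hH0 · ξ) hφc, (hmix ξ).2, hlaw, integral_withDensity_eq_integral_toReal_smul
    hcont.measurable.ennreal_ofReal (Eventually.of_forall fun _ => ENNReal.ofReal_lt_top),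
    ← setIntegral_eq_integral_of_ae_compl_eq_zero (s := Ioi 0)]
  · refine setIntegral_congr_fun measurableSet_Ioi fun s hs => ?_
    rw [ENNReal.toReal_ofReal (hnn s), abs_of_pos hs, Complex.real_smul, mul_comm]
  · refine Eventually.of_forall fun s hs => ?_
    rw [stableDens_eq_zero h0 h1 hα (fun _ _ => hY.stableDens_eq_zero h0 h1 hα) 0
      (NNReal.coe_pos.2 ht) (not_lt.1 hs)]
    simp

end StableTimeFBM

end

/-! ### Assembly of the theorem with α = β/2. -/

theorem theorem2p2 {Ω : Type*} [MeasurableSpace Ω] (μ : Measure Ω) [IsProbabilityMeasure μ]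
    (d : ℕ) (hd : 1 ≤ d) (H : ℝ) (hH0 : 0 < H) (hH1 : H < 1) (m : ℕ) (hm : 2 ≤ m)
    (β : ℝ) (hβ : β = 1 / (m : ℝ))
    (W : ℝ → Ω → EuclideanSpace ℝ (Fin d)) (hW : StableTimeFBM.IsFBMVec H W μ)
    (Y : ℝ≥0 → Ω → ℝ) (hY : StableTimeFBM.IsStableSubordinator (β / 2) Y μ)
    (hWY : IndepFun (fun ω t => W t ω) (fun ω t => Y t ω) μ)
    (p : ℝ → ℝ → ℝ) (hp : p = StableTimeFBM.pY Y μ) :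
    -- for every `t > 0`, `Y(t)` has a density, and `q(t, ·)` is the density of `W(Y(t))`
    (∀ t : ℝ≥0, 0 < t →
      HasPDF (Y t) μ volume ∧
      AEMeasurable (fun ω => W (Y t ω) ω) μ ∧
      μ.map (fun ω => W (Y t ω) ω)
        = volume.withDensity (fun x => ENNReal.ofReal (StableTimeFBM.q H p t x))) ∧
    -- the integrals defining `q` and `V_{2H-1,t} q` converge absolutely
    (∀ t : ℝ, 0 < t → ∀ x : EuclideanSpace ℝ (Fin d),
      IntegrableOn (fun s => StableTimeFBM.fH H s x * p t s) (Ioi 0) ∧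
      IntegrableOn (fun s => s ^ (2 * H - 1) * StableTimeFBM.fH H s x * p t s) (Ioi 0)) ∧
    -- the derivatives in the equation exist in the classical sense
    (∀ x : EuclideanSpace ℝ (Fin d),
      ContDiffOn ℝ (2 * m : ℕ) (fun t => StableTimeFBM.q H p t x) (Ioi 0)) ∧
    (∀ t : ℝ, 0 < t →
      ContDiff ℝ 2
        (fun x : EuclideanSpace ℝ (Fin d) => StableTimeFBM.Vq H p (2 * H - 1) t x)) ∧
    -- the partial differential equation
    (∀ t : ℝ, 0 < t → ∀ x : EuclideanSpace ℝ (Fin d),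
      iteratedDeriv (2 * m) (fun τ => StableTimeFBM.q H p τ x) t
        = -H * Laplacian.laplacian
            (fun y : EuclideanSpace ℝ (Fin d) => StableTimeFBM.Vq H p (2 * H - 1) t y) x) := by
  have hm' : (2 : ℝ) ≤ m := by exact_mod_cast hm
  have h0 : 0 < β / 2 := by
    rw [hβ]
    positivity
  have hα : β / 2 * (2 * m) = 1 := by
    rw [hβ]
    field_simp
  have h1 : β / 2 < 1 := by nlinarith
  have hvan : ∀ t s : ℝ, 0 < t → s < 0 → StableTimeFBM.stableDens (β / 2) 0 t s = 0 :=
    fun _ _ => hY.stableDens_eq_zero h0 h1 hα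
  have hpae : ∀ t : ℝ, 0 < t → p t =ᵐ[volume] StableTimeFBM.stableDens (β / 2) 0 t := by
    intro t ht
    rw [hp]
    exact hY.pY_ae_eq h0 h1 hα ht
  refine ⟨fun t ht => ⟨hY.hasPDF h0 h1 hα ht, ?_, ?_⟩, fun t ht x => ⟨?_, ?_⟩, fun x => ?_,
    fun t ht => ?_, fun t ht x => ?_⟩
  · exact StableTimeFBM.aemeasurable_comp_time hW.measurable hW.continuous_paths (hY.measurable t)
      (hY.nonneg t)
  · rw [StableTimeFBM.map_comp_subordinator hH0 hW hY h0 h1 hα hWY ht]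
    congr 1
    ext x
    rw [StableTimeFBM.q_eq_integral hpae (NNReal.coe_pos.2 ht) x]
  · exact StableTimeFBM.integrableOn_fH_mul hd hH0 h0 h1 hα hvan hpae ht x
  · exact StableTimeFBM.integrableOn_rpow_mul_fH_mul hd hH0 hH1 h0 h1 hα hvan hpae ht x
  · exact StableTimeFBM.contDiffOn_q hd hH0 h0 h1 hα hvan hpae x _
  · exact StableTimeFBM.contDiff_Vq hd hH0 hH1 h0 h1 hα hvan hpae ht
  · exact StableTimeFBM.iteratedDeriv_q_eq hd hH0 hH1 h0 h1 hα hvan hpae ht x
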